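/- Let $S^5\subset\mathbb C^3$ be the unit sphere, $S^1=\{w=e^{it}\}\subset\mathbb C$ the unit circle, and let $\pi:S^5\times S^1\to\mathbb P^2$, $\pi(u,w)=[u]$, be the composition of the projection to $S^5$ with the Hopf fibration. Let $\theta_1=\operatorname{Im}\sum_j\bar z_j\,dz_j$ be the standard connection form of the Hopf fibration, so that $d\theta_1=\pi^*\omega_{FS}$ with $\omega_{FS}=\sqrt{-1}\,\partial\bar\partial\log|z|^2$. Let $\tau\in\mathbb C$ with $\operatorname{Im}\tau\neq0$ and $\theta=\theta_1+\tau\,dt$ (the standard choice is $\tau=\sqrt{-1}$). Endow $S^5\times S^1$ with the complex structure $J$ for which $\pi$ is holomorphic and $\theta$ is of type $(1,0)$; explicitly, for a tangent vector $v=(a,b)$ at $(u,w)$, with horizontal part $v^h=a-\langle u,a\rangle u\in u^\perp\cong T_{[u]}\mathbb P^2$ (where $\langle u,a\rangle=\sum_j\bar u_ja_j$), $Jv$ is the tangent vector with $(Jv)^h=\sqrt{-1}\,v^h$ and $\theta(Jv)=\sqrt{-1}\,\theta(v)$. Then $S^5\times S^1$ with this complex structure admits no pluriclosed metric: there is no smooth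 hermitian metric, with fundamental form $\omega$ (a smooth real positive $(1,1)$-form), such that $\partial\bar\partial\omega=0$. -/

import Mathlib

open scoped Manifold

noncomputable section

/-! ### Complex-valued differential forms on a smooth manifold -/

section Forms

variable {E : Type*} [NormedAddCommGroup E] [NormedSpace ℝ E]
  {H : Type*} [TopologicalSpace H] (I : ModelWithCorners ℝ E H)
  (M : Type*) [TopologicalSpace M] [ChartedSpace H M]

/-- Complex-valued `k`-forms on `M`, with no regularity imposed. -/
abbrev DiffForm (k : ℕ) : Type _ :=
  (x : M) → (TangentSpace I x) [⋀^Fin k]→L[ℝ] ℂ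

/-- A field of endomorphisms of the tangent spaces of `M`. -/
abbrev TangentEndo : Type _ :=
  (x : M) → TangentSpace I x →L[ℝ] TangentSpace I x

variable {I M}

namespace DiffForm

/-- The expression of a form in the preferred chart at `x₀`: its pullback under the inverse of
this chart. -/
def inChart {k : ℕ} (α : DiffForm I M k) (x₀ : M) (y : E) : E [⋀^Fin k]→L[ℝ] ℂ :=
  (α ((extChartAt I x₀).symm y)).compContinuousLinearMap
    (mfderivWithin 𝓘(ℝ, E) I (extChartAt I x₀).symm (Set.range I) y)

/-- A form is smooth if its expression in every chart is smooth. -/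
def IsSmooth {k : ℕ} (α : DiffForm I M k) : Prop :=
  ∀ x₀ : M, ContDiffOn ℝ ((⊤ : ℕ∞) : WithTop ℕ∞) (α.inChart x₀) (extChartAt I x₀).target

/-- The exterior derivative, computed at `x` in the preferred chart at `x`. -/
def d {k : ℕ} (α : DiffForm I M k) : DiffForm I M (k + 1) := fun x =>
  (extDerivWithin (α.inChart x) (Set.range I) (extChartAt I x x)).compContinuousLinearMap
    (mfderiv I 𝓘(ℝ, E) (extChartAt I x) x)

end DiffForm

end Forms

/-! ### Types of forms, `∂` and `∂̄` -/

section Types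

variable {T : Type*} [AddCommGroup T] [Module ℝ T] [TopologicalSpace T]
  [IsTopologicalAddGroup T] [ContinuousSMul ℝ T]

/-- The multilinear map
`v ↦ ∑_S α_ℂ(z₀, …, z_{k-1})`, the sum over the `p`-element subsets `S` of the indices,
where `α_ℂ` is the complex multilinear extension of `α` to the complexification of `T` and `z_i` is
the `(1,0)`-part `v_i/2 - i·(J v_i)/2` of `v_i` if `i ∈ S`, its `(0,1)`-part
`v_i/2 + i·(J v_i)/2` otherwise. The extension is expanded over the set `R` of those
indices at which the imaginary part of `z_i` is chosen. -/
def typePartMultilinear {k : ℕ} (J : T →L[ℝ] T) (p : ℕ) (α : T [⋀^Fin k]→L[ℝ] ℂ) :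
    ContinuousMultilinearMap ℝ (fun _ : Fin k => T) ℂ :=
  ∑ S ∈ Finset.powersetCard p (Finset.univ : Finset (Fin k)), ∑ R : Finset (Fin k),
    Complex.I ^ R.card • α.toContinuousMultilinearMap.compContinuousLinearMap
      (fun i => if i ∈ R then (if i ∈ S then (-(1 / 2 : ℝ)) • J else (1 / 2 : ℝ) • J)
        else (1 / 2 : ℝ) • ContinuousLinearMap.id ℝ T)

theorem typePartMultilinear_apply {k : ℕ} (J : T →L[ℝ] T) (p : ℕ) (α : T [⋀^Fin k]→L[ℝ] ℂ)
    (v : Fin k → T) :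
    typePartMultilinear J p α v =
      ∑ S ∈ Finset.powersetCard p (Finset.univ : Finset (Fin k)), ∑ R : Finset (Fin k),
        Complex.I ^ R.card * α (fun i => if i ∈ R then
          (if i ∈ S then (-(1 / 2 : ℝ)) • J (v i) else (1 / 2 : ℝ) • J (v i))
            else (1 / 2 : ℝ) • v i) := by
  simp only [typePartMultilinear, sum_apply,
    smul_apply, smul_eq_mul,
    ContinuousMultilinearMap.compContinuousLinearMap_apply]
  refine Finset.sum_congr rfl fun S _ => Finset.sum_congr rfl fun R _ => ?_
  congr 1
  change α _ = α _
  congr 1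
  funext i
  split_ifs <;> simp

theorem typePartMultilinear_eq_zero {k : ℕ} (J : T →L[ℝ] T) (p : ℕ) (α : T [⋀^Fin k]→L[ℝ] ℂ)
    (v : Fin k → T) (i j : Fin k) (hv : v i = v j) (hij : i ≠ j) :
    typePartMultilinear J p α v = 0 := by
  have key : typePartMultilinear J p α v = - typePartMultilinear J p α v := by
    conv_lhs => rw [typePartMultilinear_apply]
    rw [typePartMultilinear_apply, ← Finset.sum_neg_distrib]
    set σ : Equiv.Perm (Fin k) := Equiv.swap i j with hσ
    have hvσ : ∀ l, v (σ l) = v l := by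
      intro l
      rcases eq_or_ne l i with rfl | hi
      · simp [hσ, hv]
      · rcases eq_or_ne l j with rfl | hj
        · simp [hσ, hv]
        · simp [hσ, Equiv.swap_apply_of_ne_of_ne hi hj]
    refine Finset.sum_bij' (fun S _ => S.map σ.toEmbedding) (fun S _ => S.map σ.toEmbedding)
      ?_ ?_ ?_ ?_ ?_
    · intro S hS
      simpa [Finset.mem_powersetCard] using hS
    · intro S hS
      simpa [Finset.mem_powersetCard] using hS
    · intro S _
      ext l
      simp [hσ]
    · intro S _
      ext l
      simp [hσ]
    · intro S _
      rw [← Finset.sum_neg_distrib]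
      refine Finset.sum_bij' (fun R _ => R.map σ.toEmbedding) (fun R _ => R.map σ.toEmbedding)
        (fun _ _ => Finset.mem_univ _) (fun _ _ => Finset.mem_univ _) ?_ ?_ ?_
      · intro R _
        ext l
        simp [hσ]
      · intro R _
        ext l
        simp [hσ]
      · intro R _
        rw [Finset.card_map, ← mul_neg]
        congr 1
        refine Eq.trans ?_ (α.toAlternatingMap.map_swap _ hij)
        change α _ = α _
        congr 1
        funext l
        have hmem : ∀ A : Finset (Fin k), (σ l ∈ A.map σ.toEmbedding) ↔ l ∈ A := by
          intro A
          simp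
        simp only [Function.comp_apply, ← hσ, hmem, hvσ]
  have h2 : (2 : ℂ) * typePartMultilinear J p α v = 0 := by
    linear_combination key
  simpa using h2

/-- The component of type `(p, k - p)` of a complex-valued alternating `k`-form with respect to the
complex structure `J` (for `p > k` it is zero). -/
def typePart {k : ℕ} (J : T →L[ℝ] T) (p : ℕ) (α : T [⋀^Fin k]→L[ℝ] ℂ) :
    T [⋀^Fin k]→L[ℝ] ℂ :=
  { typePartMultilinear J p α with
    map_eq_zero_of_eq' := typePartMultilinear_eq_zero J p α }

end Types

section Dolbeault

variable {E : Type*} [NormedAddCommGroup E] [NormedSpace ℝ E]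
  {H : Type*} [TopologicalSpace H] {I : ModelWithCorners ℝ E H}
  {M : Type*} [TopologicalSpace M] [ChartedSpace H M]

/-- `∂α = ∑_p (d(α^{p,q}))^{p+1,q}`, where `p + q = k`. -/
def del {k : ℕ} (J : TangentEndo I M) (α : DiffForm I M k) : DiffForm I M (k + 1) := fun x =>
  ∑ p ∈ Finset.range (k + 1),
    typePart (J x) (p + 1) (DiffForm.d (fun y => typePart (J y) p (α y)) x)

/-- `∂̄α = ∑_p (d(α^{p,q}))^{p,q+1}`, where `p + q = k`. -/
def delbar {k : ℕ} (J : TangentEndo I M) (α : DiffForm I M k) : DiffForm I M (k + 1) := fun x =>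
  ∑ p ∈ Finset.range (k + 1),
    typePart (J x) p (DiffForm.d (fun y => typePart (J y) p (α y)) x)

/-- `ω` is (the fundamental form of) a hermitian metric: a smooth, real, positive form of
type `(1,1)`. The metric is `g(v, w) = ω(v, J w)`. -/
structure IsHermitianMetric (J : TangentEndo I M) (ω : DiffForm I M 2) : Prop where
  smooth : ω.IsSmooth
  real : ∀ (x : M) (v w : TangentSpace I x), (ω x ![v, w]).im = 0
  type_one_one : ∀ (x : M) (v w : TangentSpace I x), ω x ![J x v, J x w] = ω x ![v, w]
  pos : ∀ (x : M) (v : TangentSpace I x), v ≠ 0 → 0 < (ω x ![v, J x v]).re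

/-- The metric `ω` is pluriclosed: `∂∂̄ω = 0`. -/
def IsPluriclosed (J : TangentEndo I M) (ω : DiffForm I M 2) : Prop :=
  del J (delbar J ω) = 0

end Dolbeault

/-! ### The complex manifold `S⁵ × S¹` -/

/-- `ℂ³`. -/
abbrev C3 : Type := EuclideanSpace ℂ (Fin 3)

instance finrank_C3_fact : Fact (Module.finrank ℝ C3 = 5 + 1) :=
  ⟨by rw [finrank_real_of_complex, finrank_euclideanSpace_fin]⟩

/-- The smooth manifold `S⁵ × S¹`, where `S⁵` is the unit sphere of `ℂ³`. -/
abbrev S5S1 : Type := Metric.sphere (0 : C3) 1 × Circle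

namespace S5S1

/-- The (boundaryless, six-dimensional) model of the manifold `S⁵ × S¹`. -/
abbrev model := (𝓡 5).prod (𝓡 1)

/-- The component in `T S⁵ ⊆ ℂ³` of a tangent vector at `x = (u, w)`. -/
def tangentFst (x : S5S1) : TangentSpace model x →L[ℝ] C3 :=
  mvfderiv model (fun y : S5S1 => (y.1 : C3)) x

/-- The component in `T S¹ ⊆ ℂ` of a tangent vector at `x = (u, w)`. -/
def tangentSnd (x : S5S1) : TangentSpace model x →L[ℝ] ℂ :=
  mvfderiv model (fun y : S5S1 => (y.2 : ℂ)) x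

/-- The hermitian product with `u`, i.e. `∑ conj(u_i) dz_i` restricted to `S⁵` at `x = (u, w)`.
It takes imaginary values there. -/
def hopfForm (x : S5S1) : TangentSpace model x →L[ℝ] ℂ :=
  ((innerSL ℂ (x.1 : C3)).restrictScalars ℝ).comp (tangentFst x)

/-- The connection form `Im ∑ conj(z_i) dz_i` of the Hopf fibration `S⁵ → ℙ²`, with the value `1` on
the generator `i u` of the circle action. Its differential is the pullback of the
Fubini-Study form `ω_FS = i ∂∂̄ log |z|²`. -/
def contactForm (x : S5S1) : TangentSpace model x →L[ℝ] ℝ :=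
  Complex.imCLM.comp (hopfForm x)

/-- The angular form `dt = Im (conj(w) dw)` of the circle factor, `w = exp (i t)`. -/
def angleForm (x : S5S1) : TangentSpace model x →L[ℝ] ℝ :=
  Complex.imCLM.comp
    (((ContinuousLinearMap.mul ℝ ℂ) (starRingEnd ℂ (x.2 : ℂ))).comp (tangentSnd x))

/-- The form `θ = η + τ dt`, with `η` the connection form of the Hopf fibration. -/
def theta (τ : ℂ) (x : S5S1) : TangentSpace model x →L[ℝ] ℂ :=
  (contactForm x).smulRight (1 : ℂ) + (angleForm x).smulRight τ

/-- The horizontal part `a - ⟨u, a⟩ u` of a tangent vector `(a, b)` at `x = (u, w)`. The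
horizontal space `u^⊥ ⊆ ℂ³` is identified with the tangent space of `ℙ²` at `[u]` by
the differential of the projection `π : S⁵ × S¹ → ℙ²`, and the complex structure of `ℙ²` is
multiplication by `i` on it. -/
def horizontal (x : S5S1) : TangentSpace model x →L[ℝ] C3 :=
  tangentFst x - (hopfForm x).smulRight (x.1 : C3)

/-- The horizontal part together with the value of `θ`; for `τ ∉ ℝ` it maps the tangent space
isomorphically onto `u^⊥ × ℂ`. -/
def coframe (τ : ℂ) (x : S5S1) : TangentSpace model x →L[ℝ] C3 × ℂ :=
  (horizontal x).prod (theta τ x)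

instance (x : S5S1) : FiniteDimensional ℝ (TangentSpace model x) :=
  inferInstanceAs (FiniteDimensional ℝ (EuclideanSpace ℝ (Fin 5) × EuclideanSpace ℝ (Fin 1)))

instance (x : S5S1) : T2Space (TangentSpace model x) :=
  inferInstanceAs (T2Space (EuclideanSpace ℝ (Fin 5) × EuclideanSpace ℝ (Fin 1)))

theorem tangentFst_eq (x : S5S1) (v : TangentSpace model x) :
    tangentFst x v = mvfderiv (𝓡 5) ((↑) : Metric.sphere (0 : C3) 1 → C3) x.1 v.1 := by
  have h := mfderiv_comp_apply (I := model) (I' := 𝓡 5) (I'' := 𝓘(ℝ, C3))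
    (g := ((↑) : Metric.sphere (0 : C3) 1 → C3))
    (f := (Prod.fst : S5S1 → Metric.sphere (0 : C3) 1)) x
    ((contMDiff_coe_sphere (m := 1) x.1).mdifferentiableAt one_ne_zero) mdifferentiableAt_fst v
  rw [mfderiv_fst] at h
  exact h

theorem tangentSnd_eq (x : S5S1) (v : TangentSpace model x) :
    tangentSnd x v = mvfderiv (𝓡 1) (fun z : Circle => (z : ℂ)) x.2 v.2 := by
  have hd : MDifferentiableAt (𝓡 1) 𝓘(ℝ, ℂ) (fun z : Circle => (z : ℂ)) x.2 := by
    have := finrank_real_complex_fact'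
    exact (contMDiff_coe_sphere (E := ℂ) (n := 1) (m := 1) x.2).mdifferentiableAt one_ne_zero
  have hs : MDifferentiableAt model (𝓡 1) (Prod.snd : S5S1 → Circle) x := mdifferentiableAt_snd
  have h := mfderiv_comp_apply (I := model) (I' := 𝓡 1) (I'' := 𝓘(ℝ, ℂ)) x hd hs v
  rw [mfderiv_snd] at h
  exact h

theorem range_coe_circle (w : Circle) :
    (mvfderiv (𝓡 1) (fun z : Circle => (z : ℂ)) w).range = (Submodule.span ℝ {(w : ℂ)})ᗮ := by
  have := finrank_real_complex_fact'
  exact range_mvfderiv_subtypeVal (E := ℂ) (n := 1) w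

theorem injective_coe_circle (w : Circle) :
    Function.Injective (mvfderiv (𝓡 1) (fun z : Circle => (z : ℂ)) w) := by
  have := finrank_real_complex_fact'
  exact injective_mvfderiv_subtypeVal_sphere (E := ℂ) (n := 1) w

/-- Tangent vectors are determined by their components in `ℂ³` and `ℂ`. -/
theorem tangent_ext (x : S5S1) (v v' : TangentSpace model x)
    (h1 : tangentFst x v = tangentFst x v') (h2 : tangentSnd x v = tangentSnd x v') : v = v' := by
  rw [tangentFst_eq, tangentFst_eq] at h1
  rw [tangentSnd_eq, tangentSnd_eq] at h2
  exact Prod.ext (injective_mvfderiv_subtypeVal_sphere x.1 h1) (injective_coe_circle x.2 h2)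

/-- The components in `ℂ³` are the vectors real-orthogonal to `u`, those in `ℂ` the real
multiples of `i w`. -/
theorem tangent_exists (x : S5S1) (a : C3) (s : ℝ) (ha : (inner ℂ (x.1 : C3) a).re = 0) :
    ∃ v : TangentSpace model x, tangentFst x v = a ∧ tangentSnd x v = s * Complex.I * x.2 := by
  have h1 : a ∈ (mvfderiv (𝓡 5) ((↑) : Metric.sphere (0 : C3) 1 → C3) x.1).range := by
    rw [range_mvfderiv_subtypeVal, Submodule.mem_orthogonal_singleton_iff_inner_right]
    exact ha
  have h2 : (s * Complex.I * x.2 : ℂ) ∈ (mvfderiv (𝓡 1) (fun z : Circle => (z : ℂ)) x.2).range := by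
    rw [range_coe_circle, Submodule.mem_orthogonal_singleton_iff_inner_right]
    simp [Complex.inner]
    ring
  obtain ⟨v1, hv1⟩ := h1
  obtain ⟨v2, hv2⟩ := h2
  exact ⟨(v1, v2), (tangentFst_eq x (v1, v2)).trans hv1, (tangentSnd_eq x (v1, v2)).trans hv2⟩

theorem hopfForm_re (x : S5S1) (v : TangentSpace model x) : (hopfForm x v).re = 0 := by
  have h : tangentFst x v ∈ (mvfderiv (𝓡 5) ((↑) : Metric.sphere (0 : C3) 1 → C3) x.1).range := by
    rw [tangentFst_eq]; exact ⟨_, rfl⟩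
  rw [range_mvfderiv_subtypeVal, Submodule.mem_orthogonal_singleton_iff_inner_right] at h
  exact h

theorem tangentSnd_eq_angleForm (x : S5S1) (v : TangentSpace model x) :
    tangentSnd x v = angleForm x v * Complex.I * x.2 := by
  have h : tangentSnd x v ∈ (mvfderiv (𝓡 1) (fun z : Circle => (z : ℂ)) x.2).range := by
    rw [tangentSnd_eq]; exact ⟨_, rfl⟩
  rw [range_coe_circle, Submodule.mem_orthogonal_singleton_iff_inner_right] at h
  have hw : (x.2 : ℂ) * starRingEnd ℂ (x.2 : ℂ) = 1 := by
    rw [Complex.mul_conj, Circle.normSq_coe]; simp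
  have h' : (starRingEnd ℂ (x.2 : ℂ) * tangentSnd x v).re = 0 := by
    rw [← h]; simp [Complex.inner]; try ring
  have h3 : (starRingEnd ℂ (x.2 : ℂ) * tangentSnd x v) = angleForm x v * Complex.I := by
    apply Complex.ext
    · rw [h']; simp
    · simp [angleForm]
  rw [← h3]
  linear_combination (-(tangentSnd x v)) * hw

theorem theta_apply (τ : ℂ) (x : S5S1) (v : TangentSpace model x) :
    theta τ x v = contactForm x v + angleForm x v * τ := by
  simp [theta]

theorem hopfForm_eq (x : S5S1) (v : TangentSpace model x) :
    hopfForm x v = contactForm x v * Complex.I := by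
  apply Complex.ext
  · simp [hopfForm_re]
  · simp [contactForm]

theorem coframe_ker (τ : ℂ) (hτ : τ.im ≠ 0) (x : S5S1) :
    LinearMap.ker (coframe τ x).toLinearMap = ⊥ := by
  rw [LinearMap.ker_eq_bot']
  intro v hv
  have hh : horizontal x v = 0 := congrArg Prod.fst hv
  have ht : theta τ x v = 0 := congrArg Prod.snd hv
  rw [theta_apply] at ht
  have hs : angleForm x v = 0 := by
    have := congrArg Complex.im ht
    simpa [hτ] using this
  have hr : contactForm x v = 0 := by
    have := congrArg Complex.re ht
    simpa [hs] using this
  apply tangent_ext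
  · have : tangentFst x v - hopfForm x v • (x.1 : C3) = 0 := hh
    rw [hopfForm_eq, hr] at this
    simpa using this
  · rw [tangentSnd_eq_angleForm, hs]
    simp

/-- The complex structure on `S⁵ × S¹` for which `π` is holomorphic and `θ` is of type `(1,0)`:
`J v` is the tangent vector whose horizontal part is `i` times that of `v` and for which
`θ(J v) = i θ(v)` (see `coframe_complexStructure`). -/
def complexStructure (τ : ℂ) : TangentEndo model S5S1 := fun x =>
  LinearMap.toContinuousLinearMap
    ((coframe τ x).toLinearMap.leftInverse ∘ₗ
      DistribSMul.toLinearMap ℝ (C3 × ℂ) Complex.I ∘ₗ (coframe τ x).toLinearMap)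

/-- The defining property of `complexStructure`. -/
theorem coframe_complexStructure (τ : ℂ) (hτ : τ.im ≠ 0) (x : S5S1) (v : TangentSpace model x) :
    coframe τ x (complexStructure τ x v) = Complex.I • coframe τ x v := by
  have hu : inner ℂ (x.1 : C3) (x.1 : C3) = (1 : ℂ) := by
    rw [inner_self_eq_norm_sq_to_K]
    simp
  have hw : starRingEnd ℂ (x.2 : ℂ) * (x.2 : ℂ) = 1 := by
    rw [mul_comm, Complex.mul_conj, Circle.normSq_coe]; simp
  have hinner : inner ℂ (x.1 : C3) (horizontal x v) = 0 := by
    change inner ℂ (x.1 : C3) (tangentFst x v - hopfForm x v • (x.1 : C3)) = 0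
    rw [inner_sub_right, inner_smul_right, hu, mul_one]
    exact sub_self _
  set c : ℂ := Complex.I * theta τ x v with hc
  set s : ℝ := c.im / τ.im with hs
  set r : ℝ := c.re - s * τ.re with hr
  have hrs : (r : ℂ) + s * τ = c := by
    apply Complex.ext
    · simp [hr]
    · simp [hs, hτ]
  obtain ⟨v', h1, h2⟩ := tangent_exists x
    (Complex.I • horizontal x v + (r * Complex.I) • (x.1 : C3)) s (by
      rw [inner_add_right, inner_smul_right, inner_smul_right, hu, hinner]
      simp)
  have hv' : coframe τ x v' = Complex.I • coframe τ x v := by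
    have hH : hopfForm x v' = r * Complex.I := by
      change inner ℂ (x.1 : C3) (tangentFst x v') = _
      rw [h1, inner_add_right, inner_smul_right, inner_smul_right, hu, hinner]
      simp
    have hC : contactForm x v' = r := by
      change (hopfForm x v').im = r
      rw [hH]; simp
    have hA : angleForm x v' = s := by
      change (starRingEnd ℂ (x.2 : ℂ) * tangentSnd x v').im = s
      rw [h2, show starRingEnd ℂ (x.2 : ℂ) * (s * Complex.I * x.2) = s * Complex.I by
        linear_combination (s * Complex.I) * hw]
      simp
    refine Prod.ext ?_ ?_
    · change tangentFst x v' - hopfForm x v' • (x.1 : C3) = Complex.I • horizontal x v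
      rw [h1, hH, add_sub_cancel_right]
    · change theta τ x v' = Complex.I • theta τ x v
      rw [theta_apply, hC, hA, hrs, hc, smul_eq_mul]
  have hJ : complexStructure τ x v = v' := by
    change (coframe τ x).toLinearMap.leftInverse (Complex.I • coframe τ x v) = v'
    rw [← hv']
    exact LinearMap.leftInverse_apply_of_inj (coframe_ker τ hτ x) v'
  rw [hJ, hv']

end S5S1

end

/-! The manifold is a Hopf manifold. The map `hopfCover` from `ℂ³ ∖ {0}`, built from
`exp(coverExponent τ · log|z|) z` and `exp(-i log|z| / Im τ)`, is a holomorphic local isomorphism.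
It is invariant under multiplication by `c = deckFactor τ`, and `|c| = exp(2π|Im τ|) > 1`. A
pluriclosed metric thus pulls back to a positive real (1,1)-form `β` on `ℂ³ ∖ {0}` with `∂∂̄β = 0`
and `c^*β = β`.

Conceptually, let `ω₀` be the Euclidean Kähler form. The form `ω₀/|z|²` is invariant, hence lives on
the compact quotient, and Stokes makes the integral of `β ∧ i∂∂̄(ω₀/|z|²)` vanish. But for radial `ψ
= P(|z|²)` and `s = |z|²`, the density of `β ∧ i∂∂̄ψ ∧ ω₀` is, up to a positive constant, `(sP'' +
2P') t - P'' f`, where `t` is the Euclidean trace of `β` and `f(z) = β_z(z, iz) > 0`. For `P = -1/s`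
the coefficient of `t` is zero and what remains is `2 s⁻³ f > 0`, a contradiction.

The proof unfolds this to `ℂ³` with compactly supported radial functions, so that only Lebesgue
integrals occur. Naturality of `d` (`DiffForm.extDeriv_pullback_eq`) and of types transfers `∂∂̄` to
the flat space (`IsHolomorphicChartAt.pullback_del_delbar`). There `secondDeriv_identity` turns
`∂∂̄β = 0` into a second order equation, and `integral_radial_eq_zero` integrates it against `ψ`.

The cutoff is `bump q s = step s - step (s/q)` with `q = |c|²`, whose dilates by powers of `q`
telescope to 1 on the positive axis. Taking `P' = s⁻² bump`, the homogeneities `t(z) = q t(cz)` and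
`f(z) = f(cz)` cancel all terms containing derivatives of the cutoff (`not_radial_identity`),
leaving the integral of `s⁻³ bump · f`, which is positive. -/

section Pullback

open scoped Topology ContDiff

/-! ### Smooth families of alternating forms -/

section AlternatingSmoothness

variable {D E E' G : Type*} [NormedAddCommGroup D] [NormedSpace ℝ D]
  [NormedAddCommGroup E] [NormedSpace ℝ E] [NormedAddCommGroup E'] [NormedSpace ℝ E']
  [NormedAddCommGroup G] [NormedSpace ℝ G] {k : ℕ} {n : WithTop ℕ∞}

/-- A family of alternating maps on a finite dimensional space is smooth if all its evaluations
at constant vectors are. -/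
theorem contDiffAt_continuousAlternatingMap_of_apply [FiniteDimensional ℝ E]
    [FiniteDimensional ℝ G]
    {f : D → E [⋀^Fin k]→L[ℝ] G} {x : D} (h : ∀ v, ContDiffAt ℝ n (fun y => f y v) x) :
    ContDiffAt ℝ n f x := by
  let b := Module.finBasis ℝ E
  let ev : (E [⋀^Fin k]→L[ℝ] G) →ₗ[ℝ] ((Fin k → Fin (Module.finrank ℝ E)) → G) :=
    { toFun := fun α i => α (fun j => b (i j))
      map_add' := fun _ _ => rfl
      map_smul' := fun _ _ => rfl }
  have hker : LinearMap.ker ev = ⊥ := by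
    rw [LinearMap.ker_eq_bot]
    intro α β hαβ
    apply ContinuousAlternatingMap.toAlternatingMap_injective
    apply AlternatingMap.coe_multilinearMap_injective
    exact Module.Basis.ext_multilinear (fun _ => b) fun i => congrFun hαβ i
  have hL := (LinearMap.toContinuousLinearMap ev.leftInverse).contDiff.contDiffAt.comp x
    (contDiffAt_pi.2 fun i => h (fun j => b (i j)))
  refine hL.congr_of_eventuallyEq (Filter.Eventually.of_forall fun y => ?_)
  exact (LinearMap.leftInverse_apply_of_inj hker (f y)).symm

theorem ContDiffAt.continuousAlternatingMap_comp_apply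
    {f : D → E' [⋀^Fin k]→L[ℝ] G} {g : D → E →L[ℝ] E'} {x : D}
    (hf : ContDiffAt ℝ n f x) (hg : ContDiffAt ℝ n g x) (v : Fin k → E) :
    ContDiffAt ℝ n (fun y => f y (fun i => g y (v i))) x := by
  have h1 := (ContinuousMultilinearMap.compContinuousLinearMapContinuousMultilinear ℝ
    (fun _ : Fin k => E) (fun _ : Fin k => E') G).contDiff (n := n) |>.contDiffAt.comp x
    (contDiffAt_pi.2 fun _ : Fin k => hg)
  have h2 := (ContinuousAlternatingMap.toContinuousMultilinearMapCLM ℝ :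
    (E' [⋀^Fin k]→L[ℝ] G) →L[ℝ] _).contDiff (n := n) |>.contDiffAt.comp x hf
  exact (ContinuousMultilinearMap.apply ℝ (fun _ : Fin k => E) G v).contDiff.contDiffAt.comp x
    (h1.clm_apply h2)

theorem ContDiffAt.continuousAlternatingMap_compContinuousLinearMap [FiniteDimensional ℝ E]
    [FiniteDimensional ℝ G]
    {f : D → E' [⋀^Fin k]→L[ℝ] G} {g : D → E →L[ℝ] E'} {x : D}
    (hf : ContDiffAt ℝ n f x) (hg : ContDiffAt ℝ n g x) :
    ContDiffAt ℝ n (fun y => (f y).compContinuousLinearMap (g y)) x :=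
  contDiffAt_continuousAlternatingMap_of_apply fun v =>
    hf.continuousAlternatingMap_comp_apply hg v

theorem ContDiffAt.continuousAlternatingMap_apply_const
    {f : D → E [⋀^Fin k]→L[ℝ] G} {x : D}
    (hf : ContDiffAt ℝ n f x) (v : Fin k → E) :
    ContDiffAt ℝ n (fun y => f y v) x :=
  hf.continuousAlternatingMap_comp_apply (g := fun _ => ContinuousLinearMap.id ℝ E)
    contDiffAt_const v

theorem ContDiffAt.extDeriv {f : E → E [⋀^Fin k]→L[ℝ] G} {x : E}
    (hf : ContDiffAt ℝ ∞ f x) : ContDiffAt ℝ ∞ (_root_.extDeriv f) x := by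
  have h := hf.fderiv_right (m := ∞) (by simp)
  exact (ContinuousAlternatingMap.alternatizeUncurryFinCLM ℝ E G).contDiff.contDiffAt.comp x h

end AlternatingSmoothness

/-! ### Pullback of forms from a vector space to a manifold, and its commutation with `d` -/

section Pullback

variable {E : Type*} [NormedAddCommGroup E] [NormedSpace ℝ E]
  {H : Type*} [TopologicalSpace H] {I : ModelWithCorners ℝ E H}
  {M : Type*} [TopologicalSpace M] [ChartedSpace H M]
  {V : Type*} [NormedAddCommGroup V] [NormedSpace ℝ V] {k : ℕ}

namespace DiffForm

/-- The pullback of a form under a map from a normed space. -/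
noncomputable def pullback (F : V → M) (α : DiffForm I M k) (z : V) : V [⋀^Fin k]→L[ℝ] ℂ :=
  (α (F z)).compContinuousLinearMap (mfderiv 𝓘(ℝ, V) I F z)

theorem pullback_apply (F : V → M) (α : DiffForm I M k) (z : V) (v : Fin k → V) :
    α.pullback F z v = α (F z) (fun i => mfderiv 𝓘(ℝ, V) I F z (v i)) := rfl

/-- All tangent spaces are the model space `E`, so linear maps into the fibres at `p` and at `q` can
be compared directly. This replaces transport along `p = q`. -/
theorem compContinuousLinearMap_congr (α : DiffForm I M k) {p q : M} (h : p = q)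
    {L L' : V →L[ℝ] E} (hL : L = L') :
    (α p : E [⋀^Fin k]→L[ℝ] ℂ).compContinuousLinearMap L =
      (α q : E [⋀^Fin k]→L[ℝ] ℂ).compContinuousLinearMap L' := by
  subst h hL; rfl

variable [IsManifold I ∞ M]

theorem _root_.ContMDiffAt.contDiffAt_extChartAt_comp {F : V → M} {z : V} {x₀ : M}
    (hF : ContMDiffAt 𝓘(ℝ, V) I ∞ F z) (hx₀ : F z ∈ (extChartAt I x₀).source) :
    ContDiffAt ℝ ∞ (fun y => extChartAt I x₀ (F y)) z := by
  rw [extChartAt_source] at hx₀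
  exact ((contMDiffAt_extChartAt' hx₀).comp z hF).contDiffAt

variable [I.Boundaryless]

theorem pullback_eventuallyEq_inChart {F : V → M} {z : V}
    (hF : ∀ᶠ y in 𝓝 z, ContMDiffAt 𝓘(ℝ, V) I ∞ F y) (α : DiffForm I M k) :
    α.pullback F =ᶠ[𝓝 z] fun y => (α.inChart (F z) (extChartAt I (F z) (F y))).compContinuousLinearMap
      (fderiv ℝ (fun y => extChartAt I (F z) (F y)) y) := by
  have h2 : ∀ᶠ y in 𝓝 z, F y ∈ (extChartAt I (F z)).source :=
    hF.self_of_nhds.continuousAt.eventually (extChartAt_source_mem_nhds (F z))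
  filter_upwards [hF, h2, h2.eventually_nhds] with y hy1 hy2 hy3
  refine compContinuousLinearMap_congr (V := V) α ((extChartAt I (F z)).left_inv hy2).symm
    (L' := ContinuousLinearMap.comp (M₂ := E)
      (mfderivWithin 𝓘(ℝ, E) I (extChartAt I (F z)).symm (Set.range I)
        (extChartAt I (F z) (F y)))
      (fderiv ℝ (fun y => extChartAt I (F z) (F y)) y)) ?_
  have hsymm : MDifferentiableAt 𝓘(ℝ, E) I (extChartAt I (F z)).symm (extChartAt I (F z) (F y)) :=
    by
      have := mdifferentiableWithinAt_extChartAt_symm (I := I) (x := F z)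
        ((extChartAt I (F z)).map_source hy2)
      rwa [I.range_eq_univ, mdifferentiableWithinAt_univ] at this
  have hφ : MDifferentiableAt 𝓘(ℝ, V) 𝓘(ℝ, E) (fun y => extChartAt I (F z) (F y)) y :=
    ((hy1.contDiffAt_extChartAt_comp hy2).differentiableAt (by simp)).mdifferentiableAt
  have hcomp := mfderiv_comp y hsymm hφ
  have heq : (extChartAt I (F z)).symm ∘ (fun y => extChartAt I (F z) (F y)) =ᶠ[𝓝 y] F := by
    filter_upwards [hy3] with w hw using (extChartAt I (F z)).left_inv hw
  rw [heq.mfderiv_eq, mfderiv_eq_fderiv] at hcomp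
  rw [I.range_eq_univ, mfderivWithin_univ]
  exact hcomp

theorem IsSmooth.contDiffAt_pullback [FiniteDimensional ℝ V] {F : V → M} {z : V}
    (hF : ∀ᶠ y in 𝓝 z, ContMDiffAt 𝓘(ℝ, V) I ∞ F y) {α : DiffForm I M k} (hα : α.IsSmooth) :
    ContDiffAt ℝ ∞ (α.pullback F) z := by
  refine ContDiffAt.congr_of_eventuallyEq ?_ (pullback_eventuallyEq_inChart hF α)
  have hφ := hF.self_of_nhds.contDiffAt_extChartAt_comp (mem_extChartAt_source (I := I) (F z))
  refine ContDiffAt.continuousAlternatingMap_compContinuousLinearMap ?_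
    (hφ.fderiv_right (m := ∞) (by simp))
  refine ContDiffAt.comp (g := α.inChart (F z)) z ?_ hφ
  refine (hα (F z)).contDiffAt ?_
  exact extChartAt_target_mem_nhds (F z)

/-- The exterior derivative commutes with pullback under a local diffeomorphism. Only the pullback
is assumed to be differentiable. -/
theorem extDeriv_pullback_eq [CompleteSpace V] {F : V → M} {z : V}
    (hF : ∀ᶠ y in 𝓝 z, ContMDiffAt 𝓘(ℝ, V) I ∞ F y)
    (hF' : (mfderiv 𝓘(ℝ, V) I F z).IsInvertible)
    (α : DiffForm I M k) (hα : DifferentiableAt ℝ (α.pullback F) z) :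
    extDeriv (α.pullback F) z = α.d.pullback F z := by
  set φ := extChartAt I (F z) with hφdef
  set f : V → E := fun y => φ (F y) with hfdef
  have hφs : F z ∈ φ.source := mem_extChartAt_source (F z)
  have hf : ContDiffAt ℝ ∞ f z := hF.self_of_nhds.contDiffAt_extChartAt_comp hφs
  have hφd : MDifferentiableAt I 𝓘(ℝ, E) φ (F z) :=
    mdifferentiableAt_extChartAt (mem_chart_source H (F z))
  have hFd : MDifferentiableAt 𝓘(ℝ, V) I F z := hF.self_of_nhds.mdifferentiableAt (by simp)
  have hfd : fderiv ℝ f z = (mfderiv I 𝓘(ℝ, E) φ (F z)).comp (mfderiv 𝓘(ℝ, V) I F z) := by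
    rw [← mfderiv_eq_fderiv]
    exact mfderiv_comp z hφd hFd
  have hinv : (fderiv ℝ f z).IsInvertible := by
    rw [hfd]
    exact (isInvertible_mfderiv_extChartAt hφs).comp hF'
  obtain ⟨e, he⟩ := hinv
  have hfe : HasFDerivAt f (e : V →L[ℝ] E) z := by
    rw [he]; exact (hf.differentiableAt (by simp)).hasFDerivAt
  set G := hf.localInverse hfe (by simp) with hG
  have hGz : G (f z) = z := hf.localInverse_apply_image hfe (by simp)
  have hGs : ContDiffAt ℝ ∞ G (f z) := hf.to_localInverse hfe (by simp)
  have hfG : ∀ᶠ y in 𝓝 (f z), f (G y) = y :=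
    (hf.hasStrictFDerivAt' hfe (by simp)).eventually_right_inverse
  have hGt : Filter.Tendsto G (𝓝 (f z)) (𝓝 z) := by
    have := hGs.continuousAt.tendsto; rwa [hGz] at this
  have hGd : ∀ᶠ y in 𝓝 (f z), DifferentiableAt ℝ G y := by
    filter_upwards [(hGs.of_le (m := 1) (by simp)).eventually (by simp)] with y hy
    exact hy.differentiableAt (by simp)
  have hsrc : ∀ᶠ y in 𝓝 z, F y ∈ φ.source :=
    hF.self_of_nhds.continuousAt.eventually (extChartAt_source_mem_nhds (F z))
  have hFG : ∀ᶠ y in 𝓝 (f z), F (G y) = φ.symm y := by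
    filter_upwards [hfG, hGt.eventually hsrc] with y hy1 hy2
    rw [← φ.left_inv hy2]
    exact congrArg φ.symm hy1
  -- Near `f z` the inverse chart is `F ∘ G`, so the chart expression of `α` is the pullback by `G`
  -- of `α.pullback F`. Naturality of `extDeriv` between vector spaces then suffices, and no
  -- regularity of `α` on `M` is needed.
  have key : α.inChart (F z) =ᶠ[𝓝 (f z)]
      fun y => (α.pullback F (G y)).compContinuousLinearMap (fderiv ℝ G y) := by
    filter_upwards [hFG, hFG.eventually_nhds, hGd, hGt.eventually hF] with y hy1 hy2 hy3 hy4
    refine compContinuousLinearMap_congr (V := E) α hy1.symm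
      (L' := ContinuousLinearMap.comp (M₂ := V) (mfderiv 𝓘(ℝ, V) I F (G y)) (fderiv ℝ G y)) ?_
    rw [I.range_eq_univ, mfderivWithin_univ]
    have hcomp := mfderiv_comp y (hy4.mdifferentiableAt (by simp)) hy3.mdifferentiableAt
    have heq : F ∘ G =ᶠ[𝓝 y] φ.symm := hy2
    rw [heq.mfderiv_eq, mfderiv_eq_fderiv] at hcomp
    exact hcomp
  have hext : extDerivWithin (α.inChart (F z)) (Set.range I) (f z) =
      (extDeriv (α.pullback F) z).compContinuousLinearMap (fderiv ℝ G (f z)) := by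
    rw [I.range_eq_univ, extDerivWithin_univ, key.extDeriv_eq,
      extDeriv_pullback (r := ∞) (by rwa [hGz]) hGs
        (by simpa using (ENat.LEInfty.out : (2 : WithTop ℕ∞) ≤ ∞)), hGz]
  have hGf : (fderiv ℝ G (f z)).comp (fderiv ℝ f z) = ContinuousLinearMap.id ℝ V := by
    have h1 : HasFDerivAt G (e.symm : E →L[ℝ] V) (f z) :=
      ((hf.hasStrictFDerivAt' hfe (by simp)).to_localInverse).hasFDerivAt
    rw [h1.fderiv, ← he]
    ext v
    simp
  ext v
  have h2 : α.d.pullback F z v =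
      extDerivWithin (α.inChart (F z)) (Set.range I) (f z) (fun i => fderiv ℝ f z (v i)) := by
    rw [hfd]; rfl
  rw [h2, hext]
  change _ = extDeriv (α.pullback F) z (fun i => ((fderiv ℝ G (f z)).comp (fderiv ℝ f z)) (v i))
  rw [hGf]
  rfl

end DiffForm
end Pullback

end Pullback

/-! ### Pointwise algebra of types for 2-, 3- and 4-forms -/

section TypeDecomposition

open scoped Topology ContDiff

section TypeAlgebra

variable {T : Type*} [AddCommGroup T] [Module ℝ T] [TopologicalSpace T]
  [IsTopologicalAddGroup T] [ContinuousSMul ℝ T] {k : ℕ}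

theorem typePart_apply (J : T →L[ℝ] T) (p : ℕ) (α : T [⋀^Fin k]→L[ℝ] ℂ) (v : Fin k → T) :
    typePart J p α v =
      ∑ S ∈ Finset.powersetCard p (Finset.univ : Finset (Fin k)), ∑ R : Finset (Fin k),
        Complex.I ^ R.card * α (fun i => if i ∈ R then
          (if i ∈ S then (-(1 / 2 : ℝ)) • J (v i) else (1 / 2 : ℝ) • J (v i))
            else (1 / 2 : ℝ) • v i) :=
  typePartMultilinear_apply J p α v

/-- Exchanging the sums over `S` and `R` collects the signs into an integer depending only on `p`,
`k` and the size of `R` (a Krawtchouk number). For `k = 2, 3, 4` these integers are then found by a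
finite check. -/
theorem typePart_apply_eq_sum (J : T →L[ℝ] T) (p : ℕ) (α : T [⋀^Fin k]→L[ℝ] ℂ) (v : Fin k → T) :
    typePart J p α v = ∑ R : Finset (Fin k),
      ((∑ S ∈ Finset.powersetCard p (Finset.univ : Finset (Fin k)), (-1 : ℤ) ^ (R ∩ S).card : ℤ)
          : ℂ) * (1 / 2) ^ k * Complex.I ^ R.card *
        α (fun i => if i ∈ R then J (v i) else v i) := by
  rw [typePart_apply, Finset.sum_comm]
  refine Finset.sum_congr rfl fun R _ => ?_
  push_cast
  rw [Finset.sum_mul, Finset.sum_mul, Finset.sum_mul]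
  refine Finset.sum_congr rfl fun S _ => ?_
  have h : (fun i => if i ∈ R then
          (if i ∈ S then (-(1 / 2 : ℝ)) • J (v i) else (1 / 2 : ℝ) • J (v i))
            else (1 / 2 : ℝ) • v i) =
      fun i => ((if i ∈ R ∩ S then (-1 : ℝ) else 1) * (1 / 2)) •
        (if i ∈ R then J (v i) else v i) := by
    funext i
    by_cases h1 : i ∈ R <;> by_cases h2 : i ∈ S <;> simp [h1, h2]
  have h2 : α (fun i => ((if i ∈ R ∩ S then (-1 : ℝ) else 1) * (1 / 2)) •
        (if i ∈ R then J (v i) else v i)) =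
      (∏ i : Fin k, ((if i ∈ R ∩ S then (-1 : ℝ) else 1) * (1 / 2))) •
        α (fun i => if i ∈ R then J (v i) else v i) :=
    α.toContinuousMultilinearMap.map_smul_univ _ _
  rw [h, h2, Finset.prod_mul_distrib, Finset.prod_ite_mem, Finset.univ_inter, Finset.prod_const,
    Finset.prod_const, Finset.card_univ, Fintype.card_fin, Complex.real_smul]
  push_cast
  ring

@[simp]
theorem typePart_zero (J : T →L[ℝ] T) (p : ℕ) :
    typePart J p (0 : T [⋀^Fin k]→L[ℝ] ℂ) = 0 := by
  ext v
  simp [typePart_apply_eq_sum]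

/-- Decomposition into types is compatible with complex linear maps. -/
theorem typePart_compContinuousLinearMap {T' : Type*} [AddCommGroup T'] [Module ℝ T']
    [TopologicalSpace T'] [IsTopologicalAddGroup T'] [ContinuousSMul ℝ T']
    (J : T →L[ℝ] T) (J' : T' →L[ℝ] T') (L : T →L[ℝ] T')
    (h : ∀ v, L (J v) = J' (L v)) (p : ℕ) (α : T' [⋀^Fin k]→L[ℝ] ℂ) :
    (typePart J' p α).compContinuousLinearMap L =
      typePart J p (α.compContinuousLinearMap L) := by
  ext v
  change typePart J' p α (fun i => L (v i)) = _
  rw [typePart_apply_eq_sum, typePart_apply_eq_sum]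
  refine Finset.sum_congr rfl fun R _ => ?_
  congr 1
  change _ = α (fun i => L (if i ∈ R then J (v i) else v i))
  congr 1
  funext i
  split_ifs <;> simp [h]

variable (J : T →L[ℝ] T)

theorem typePart_two_form (p : ℕ) (hp : p < 3) (α : T [⋀^Fin 2]→L[ℝ] ℂ) (a b : T) :
    typePart J p α ![a, b] = 1 / 4 * ((![1, 2, 1] : Fin 3 → ℂ) ⟨p, hp⟩ * α ![a, b]
      + (![1, 0, -1] : Fin 3 → ℂ) ⟨p, hp⟩ * Complex.I * (α ![J a, b] + α ![a, J b])
      - (![1, -2, 1] : Fin 3 → ℂ) ⟨p, hp⟩ * α ![J a, J b]) := by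
  rw [typePart_apply_eq_sum,
    show (Finset.univ : Finset (Finset (Fin 2))) = {∅, {0}, {1}, {0, 1}} by decide]
  have e0 : (fun i => if i ∈ (∅ : Finset (Fin 2)) then J (![a, b] i) else ![a, b] i) = ![a, b] := by
    funext i; fin_cases i <;> simp
  have e1 : (fun i => if i ∈ ({0} : Finset (Fin 2)) then J (![a, b] i) else ![a, b] i)
    = ![J a, b] := by
    funext i; fin_cases i <;> simp
  have e2 : (fun i => if i ∈ ({1} : Finset (Fin 2)) then J (![a, b] i) else ![a, b] i)
    = ![a, J b] := by
    funext i; fin_cases i <;> simp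
  have e3 : (fun i => if i ∈ ({0, 1} : Finset (Fin 2)) then J (![a, b] i) else ![a, b] i)
    = ![J a, J b] := by
    funext i; fin_cases i <;> simp
  have hc : ∀ p : Fin 3, ∀ R : Finset (Fin 2),
      ∑ S ∈ Finset.powersetCard p.1 (Finset.univ : Finset (Fin 2)), (-1 : ℤ) ^ (R ∩ S).card =
        (![![1, 1, 1], ![2, 0, -2], ![1, -1, 1]] : Fin 3 → Fin 3 → ℤ) p
          ⟨R.card, Nat.lt_succ_of_le (Finset.card_le_univ R)⟩ := by decide
  have hc' := hc ⟨p, hp⟩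
  simp only at hc'
  simp only [hc']
  rw [Finset.sum_insert (by decide), Finset.sum_insert (by decide), Finset.sum_insert (by decide),
    Finset.sum_singleton, e0, e1, e2, e3]
  interval_cases p <;> simp <;> ring


theorem typePart_three_form (p : ℕ) (hp : p < 4) (α : T [⋀^Fin 3]→L[ℝ] ℂ) (a b c : T) :
    typePart J p α ![a, b, c] = 1 / 8 * ((![1, 3, 3, 1] : Fin 4 → ℂ) ⟨p, hp⟩ * α ![a, b, c]
      + (![1, 1, -1, -1] : Fin 4 → ℂ) ⟨p, hp⟩ * Complex.I *
        (α ![J a, b, c] + α ![a, J b, c] + α ![a, b, J c])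
      - (![1, -1, -1, 1] : Fin 4 → ℂ) ⟨p, hp⟩ *
        (α ![J a, J b, c] + α ![J a, b, J c] + α ![a, J b, J c])
      - (![1, -3, 3, -1] : Fin 4 → ℂ) ⟨p, hp⟩ * Complex.I * α ![J a, J b, J c]) := by
  rw [typePart_apply_eq_sum, show (Finset.univ : Finset (Finset (Fin 3))) =
    {∅, {0}, {1}, {2}, {0, 1}, {0, 2}, {1, 2}, {0, 1, 2}} by decide]
  have e : ∀ R : Finset (Fin 3), (fun i => if i ∈ R then J (![a, b, c] i) else ![a, b, c] i) =
      ![if 0 ∈ R then J a else a, if 1 ∈ R then J b else b, if 2 ∈ R then J c else c] := by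
    intro R; funext i; fin_cases i <;> rfl
  have hc : ∀ p : Fin 4, ∀ R : Finset (Fin 3),
      ∑ S ∈ Finset.powersetCard p.1 (Finset.univ : Finset (Fin 3)), (-1 : ℤ) ^ (R ∩ S).card =
        (![![1, 1, 1, 1], ![3, 1, -1, -3], ![3, -1, -1, 3], ![1, -1, 1, -1]] :
          Fin 4 → Fin 4 → ℤ) p ⟨R.card, Nat.lt_succ_of_le (Finset.card_le_univ R)⟩ := by decide
  have hc' := hc ⟨p, hp⟩
  simp only at hc'
  simp only [hc', e]
  iterate 7 rw [Finset.sum_insert (by decide)]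
  rw [Finset.sum_singleton]
  interval_cases p <;> simp [pow_succ] <;> ring

/-- Terms with an odd number of `J` are absent: complementing the 2-element set `S` reverses the
sign of each such term. -/
theorem typePart_two_four_form (α : T [⋀^Fin 4]→L[ℝ] ℂ) (a b c d : T) :
    typePart J 2 α ![a, b, c, d] = 1 / 8 * (3 * α ![a, b, c, d]
      + (α ![J a, J b, c, d] + α ![J a, b, J c, d] + α ![J a, b, c, J d]
        + α ![a, J b, J c, d] + α ![a, J b, c, J d] + α ![a, b, J c, J d])
      + 3 * α ![J a, J b, J c, J d]) := by
  rw [typePart_apply_eq_sum, show (Finset.univ : Finset (Finset (Fin 4))) =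
    {∅, {0}, {1}, {2}, {3}, {0, 1}, {0, 2}, {0, 3}, {1, 2}, {1, 3}, {2, 3}, {0, 1, 2},
      {0, 1, 3}, {0, 2, 3}, {1, 2, 3}, {0, 1, 2, 3}} by decide]
  have e : ∀ R : Finset (Fin 4), (fun i => if i ∈ R then J (![a, b, c, d] i) else ![a, b, c, d] i) =
      ![if 0 ∈ R then J a else a, if 1 ∈ R then J b else b, if 2 ∈ R then J c else c,
        if 3 ∈ R then J d else d] := by
    intro R; funext i; fin_cases i <;> rfl
  have hc : ∀ R : Finset (Fin 4),
      ∑ S ∈ Finset.powersetCard 2 (Finset.univ : Finset (Fin 4)), (-1 : ℤ) ^ (R ∩ S).card =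
        (![6, 0, -2, 0, 6] : Fin 5 → ℤ)
          ⟨R.card, Nat.lt_succ_of_le (Finset.card_le_univ R)⟩ := by decide
  simp only [hc, e]
  iterate 15 rw [Finset.sum_insert (by decide)]
  rw [Finset.sum_singleton]
  simp
  ring

end TypeAlgebra

end TypeDecomposition

/-! ### Dolbeault operators for a constant complex structure -/

section FlatDolbeaultIdentity

open scoped Topology ContDiff

section FlatDolbeault

variable {V : Type*} [NormedAddCommGroup V] [NormedSpace ℝ V] {k : ℕ}

theorem ContDiffAt.typePart [FiniteDimensional ℝ V] {f : V → V [⋀^Fin k]→L[ℝ] ℂ} {z : V}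
    {n : WithTop ℕ∞} (hf : ContDiffAt ℝ n f z) (J : V →L[ℝ] V) (p : ℕ) :
    ContDiffAt ℝ n (fun y => _root_.typePart J p (f y)) z := by
  refine contDiffAt_continuousAlternatingMap_of_apply fun v => ?_
  simp only [typePart_apply_eq_sum]
  exact ContDiffAt.sum fun R _ => contDiffAt_const.mul (hf.continuousAlternatingMap_apply_const _)

/-- The operator `∂` on forms on a vector space with a constant complex structure. -/
noncomputable def flatDel (J : V →L[ℝ] V) (α : V → V [⋀^Fin k]→L[ℝ] ℂ) (z : V) :
    V [⋀^Fin (k + 1)]→L[ℝ] ℂ :=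
  ∑ p ∈ Finset.range (k + 1), typePart J (p + 1) (extDeriv (fun y => typePart J p (α y)) z)

/-- The operator `∂̄` on forms on a vector space with a constant complex structure. -/
noncomputable def flatDelbar (J : V →L[ℝ] V) (α : V → V [⋀^Fin k]→L[ℝ] ℂ) (z : V) :
    V [⋀^Fin (k + 1)]→L[ℝ] ℂ :=
  ∑ p ∈ Finset.range (k + 1), typePart J p (extDeriv (fun y => typePart J p (α y)) z)

theorem flatDel_congr {J : V →L[ℝ] V} {α β : V → V [⋀^Fin k]→L[ℝ] ℂ} {z : V}
    (h : α =ᶠ[𝓝 z] β) : flatDel J α z = flatDel J β z := by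
  refine Finset.sum_congr rfl fun p _ => ?_
  congr 1
  refine Filter.EventuallyEq.extDeriv_eq ?_
  filter_upwards [h] with y hy
  rw [hy]

theorem ContDiffAt.flatDelbar [FiniteDimensional ℝ V] {f : V → V [⋀^Fin k]→L[ℝ] ℂ} {z : V}
    (hf : ContDiffAt ℝ ∞ f z) (J : V →L[ℝ] V) :
    ContDiffAt ℝ ∞ (_root_.flatDelbar J f) z :=
  ContDiffAt.sum fun p _ => ((hf.typePart J p).extDeriv).typePart J p

end FlatDolbeault

/-! ### Transfer of `∂` and `∂̄` through holomorphic charts -/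

section PullbackDolbeault

variable {E : Type*} [NormedAddCommGroup E] [NormedSpace ℝ E]
  {H : Type*} [TopologicalSpace H] {I : ModelWithCorners ℝ E H}
  {M : Type*} [TopologicalSpace M] [ChartedSpace H M]
  {V : Type*} [NormedAddCommGroup V] [NormedSpace ℝ V] {k : ℕ}

/-- The differential of `F` at `z` is an isomorphism of complex vector spaces, and `F` is smooth
near `z`. -/
structure IsHolomorphicChartAt (J₀ : V →L[ℝ] V) (J : TangentEndo I M) (F : V → M) (z : V) :
    Prop where
  smooth : ∀ᶠ y in 𝓝 z, ContMDiffAt 𝓘(ℝ, V) I ∞ F y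
  invertible : (mfderiv 𝓘(ℝ, V) I F z).IsInvertible
  comm : ∀ v : V, mfderiv 𝓘(ℝ, V) I F z (J₀ v) = J (F z) (mfderiv 𝓘(ℝ, V) I F z v)

variable {J₀ : V →L[ℝ] V} {J : TangentEndo I M} {F : V → M} {z : V}

theorem IsHolomorphicChartAt.pullback_typePart (h : IsHolomorphicChartAt J₀ J F z) (p : ℕ)
    (α : DiffForm I M k) :
    DiffForm.pullback F (fun y => typePart (J y) p (α y)) z =
      typePart J₀ p (α.pullback F z) :=
  typePart_compContinuousLinearMap J₀ (J (F z)) (mfderiv 𝓘(ℝ, V) I F z) h.comm p (α (F z))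

variable [I.Boundaryless] [IsManifold I ∞ M] [FiniteDimensional ℝ V]

theorem IsHolomorphicChartAt.pullback_d_typePart
    (h : ∀ᶠ y in 𝓝 z, IsHolomorphicChartAt J₀ J F y) {α : DiffForm I M k}
    (hα : ContDiffAt ℝ ∞ (α.pullback F) z) (p q : ℕ) :
    DiffForm.pullback F
      (fun x => typePart (J x) q (DiffForm.d (fun y => typePart (J y) p (α y)) x)) z =
      typePart J₀ q (extDeriv (fun y => typePart J₀ p (α.pullback F y)) z) := by
  have hev : DiffForm.pullback F (fun y => typePart (J y) p (α y)) =ᶠ[𝓝 z]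
      fun y => typePart J₀ p (α.pullback F y) := by
    filter_upwards [h] with y hy using hy.pullback_typePart p α
  have h0 := h.self_of_nhds
  rw [h0.pullback_typePart q, ← hev.extDeriv_eq,
    DiffForm.extDeriv_pullback_eq h0.smooth h0.invertible]
  exact ((hα.typePart J₀ p).congr_of_eventuallyEq hev).differentiableAt (by simp)

theorem IsHolomorphicChartAt.pullback_del (h : ∀ᶠ y in 𝓝 z, IsHolomorphicChartAt J₀ J F y)
    {α : DiffForm I M k} (hα : ContDiffAt ℝ ∞ (α.pullback F) z) :
    (del J α).pullback F z = flatDel J₀ (α.pullback F) z := by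
  rw [flatDel, ← Finset.sum_congr rfl fun p _ => pullback_d_typePart h hα p (p + 1)]
  ext v
  simp [DiffForm.pullback_apply, del]

theorem IsHolomorphicChartAt.pullback_delbar (h : ∀ᶠ y in 𝓝 z, IsHolomorphicChartAt J₀ J F y)
    {α : DiffForm I M k} (hα : ContDiffAt ℝ ∞ (α.pullback F) z) :
    (delbar J α).pullback F z = flatDelbar J₀ (α.pullback F) z := by
  rw [flatDelbar, ← Finset.sum_congr rfl fun p _ => pullback_d_typePart h hα p p]
  ext v
  simp [DiffForm.pullback_apply, delbar]

/-- The comparison for `∂̄` holds on a neighbourhood, so it can be differentiated. Smoothness of the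
pulled back `∂̄α` is read off from the flat side, and that of `∂̄α` on `M` is never required. -/
theorem IsHolomorphicChartAt.pullback_del_delbar
    (h : ∀ᶠ y in 𝓝 z, IsHolomorphicChartAt J₀ J F y) {α : DiffForm I M k}
    (hα : ∀ᶠ y in 𝓝 z, ContDiffAt ℝ ∞ (α.pullback F) y) :
    (del J (delbar J α)).pullback F z = flatDel J₀ (flatDelbar J₀ (α.pullback F)) z := by
  have hev : (delbar J α).pullback F =ᶠ[𝓝 z] flatDelbar J₀ (α.pullback F) := by
    filter_upwards [h.eventually_nhds, hα] with y hy1 hy2 using pullback_delbar hy1 hy2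
  rw [pullback_del h ((hα.self_of_nhds.flatDelbar J₀).congr_of_eventuallyEq hev),
    flatDel_congr hev]

end PullbackDolbeault

/-! ### The equation `∂∂̄β = 0` for a (1,1)-form as a second order equation -/

section FlatPluriclosed

variable {V : Type*} [NormedAddCommGroup V] [NormedSpace ℝ V] 

theorem extDeriv_two_form {β : V → V [⋀^Fin 2]→L[ℝ] ℂ} {z : V} (h : DifferentiableAt ℝ β z)
    (a b c : V) :
    extDeriv β z ![a, b, c] = fderiv ℝ (fun y => β y ![b, c]) z a
      - fderiv ℝ (fun y => β y ![a, c]) z b + fderiv ℝ (fun y => β y ![a, b]) z c := by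
  rw [extDeriv_apply h]
  have e0 : Fin.removeNth 0 ![a, b, c] = ![b, c] := by funext i; fin_cases i <;> rfl
  have e1 : Fin.removeNth 1 ![a, b, c] = ![a, c] := by funext i; fin_cases i <;> rfl
  have e2 : Fin.removeNth 2 ![a, b, c] = ![a, b] := by funext i; fin_cases i <;> rfl
  rw [Fin.sum_univ_three, e0, e1, e2]
  simp [sub_eq_add_neg]

theorem extDeriv_three_form {β : V → V [⋀^Fin 3]→L[ℝ] ℂ} {z : V} (h : DifferentiableAt ℝ β z)
    (a b c d : V) :
    extDeriv β z ![a, b, c, d] = fderiv ℝ (fun y => β y ![b, c, d]) z a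
      - fderiv ℝ (fun y => β y ![a, c, d]) z b + fderiv ℝ (fun y => β y ![a, b, d]) z c
      - fderiv ℝ (fun y => β y ![a, b, c]) z d := by
  rw [extDeriv_apply h]
  have e0 : Fin.removeNth 0 ![a, b, c, d] = ![b, c, d] := by funext i; fin_cases i <;> rfl
  have e1 : Fin.removeNth 1 ![a, b, c, d] = ![a, c, d] := by funext i; fin_cases i <;> rfl
  have e2 : Fin.removeNth 2 ![a, b, c, d] = ![a, b, d] := by funext i; fin_cases i <;> rfl
  have e3 : Fin.removeNth 3 ![a, b, c, d] = ![a, b, c] := by funext i; fin_cases i <;> rfl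
  rw [Fin.sum_univ_four, e0, e1, e2, e3]
  simp [pow_succ, sub_eq_add_neg]


variable {J : V →L[ℝ] V}

theorem typePart_one_of_invariant {α : V [⋀^Fin 2]→L[ℝ] ℂ}
    (hα : ∀ a b, α ![J a, J b] = α ![a, b]) : typePart J 1 α = α := by
  ext v
  rw [show v = ![v 0, v 1] by funext i; fin_cases i <;> rfl, typePart_two_form J 1 (by norm_num), hα]
  simp
  ring

theorem map_left_eq_neg (hJ : ∀ v, J (J v) = -v) {α : V [⋀^Fin 2]→L[ℝ] ℂ}
    (hα : ∀ a b, α ![J a, J b] = α ![a, b]) (a b : V) : α ![J a, b] = -α ![a, J b] := by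
  have h := hα (J a) b
  rw [← h, hJ]
  have := α.toAlternatingMap.map_update_neg ![a, J b] 0 a
  rwa [show Function.update ![a, J b] 0 (-a) = ![-a, J b] by funext i; fin_cases i <;> rfl,
    show Function.update ![a, J b] 0 a = ![a, J b] by funext i; fin_cases i <;> rfl] at this

theorem typePart_eq_zero_of_invariant (hJ : ∀ v, J (J v) = -v) {α : V [⋀^Fin 2]→L[ℝ] ℂ}
    (hα : ∀ a b, α ![J a, J b] = α ![a, b]) {p : ℕ} (hp : p < 3) (hp1 : p ≠ 1) :
    typePart J p α = 0 := by
  ext v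
  rw [show v = ![v 0, v 1] by funext i; fin_cases i <;> rfl, typePart_two_form J p hp, hα,
    map_left_eq_neg hJ hα]
  interval_cases p <;> simp at hp1 ⊢

variable {β : V → V [⋀^Fin 2]→L[ℝ] ℂ} {z : V}

theorem fderiv_left_eq_neg (hJ : ∀ v, J (J v) = -v)
    (hβ : ∀ᶠ y in 𝓝 z, ∀ a b, β y ![J a, J b] = β y ![a, b]) (a b : V) :
    fderiv ℝ (fun y => β y ![J a, b]) z = -fderiv ℝ (fun y => β y ![a, J b]) z := by
  rw [← fderiv_neg]
  refine Filter.EventuallyEq.fderiv_eq ?_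
  filter_upwards [hβ] with y hy using map_left_eq_neg hJ hy a b

theorem map_right_neg (α : V [⋀^Fin 2]→L[ℝ] ℂ) (a b : V) : α ![a, -b] = -α ![a, b] := by
  have := α.toAlternatingMap.map_update_neg ![a, b] 1 b
  rwa [show Function.update ![a, b] 1 (-b) = ![a, -b] by funext i; fin_cases i <;> rfl,
    show Function.update ![a, b] 1 b = ![a, b] by funext i; fin_cases i <;> rfl] at this

theorem map_left_neg (α : V [⋀^Fin 2]→L[ℝ] ℂ) (a b : V) : α ![-a, b] = -α ![a, b] := by
  have := α.toAlternatingMap.map_update_neg ![a, b] 0 a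
  rwa [show Function.update ![a, b] 0 (-a) = ![-a, b] by funext i; fin_cases i <;> rfl,
    show Function.update ![a, b] 0 a = ![a, b] by funext i; fin_cases i <;> rfl] at this

theorem flatDelbar_eq (hJ : ∀ v, J (J v) = -v)
    (hβ : ∀ᶠ y in 𝓝 z, ∀ a b, β y ![J a, J b] = β y ![a, b]) :
    flatDelbar J β z = typePart J 1 (extDeriv β z) := by
  have h : ∀ p, p < 3 → p ≠ 1 → extDeriv (fun y => typePart J p (β y)) z = 0 := by
    intro p hp hp1
    have : (fun y => typePart J p (β y)) =ᶠ[𝓝 z] fun _ => 0 := by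
      filter_upwards [hβ] with y hy using typePart_eq_zero_of_invariant hJ hy hp hp1
    rw [this.extDeriv_eq, extDeriv, fderiv_fun_const]
    exact map_zero (ContinuousAlternatingMap.alternatizeUncurryFinCLM ℝ V ℂ)
  have h1 : (fun y => typePart J 1 (β y)) =ᶠ[𝓝 z] β := by
    filter_upwards [hβ] with y hy using typePart_one_of_invariant hy
  rw [flatDelbar, Finset.sum_range_succ, Finset.sum_range_succ, Finset.sum_range_one,
    h 0 (by norm_num) (by norm_num), h 2 (by norm_num) (by norm_num), h1.extDeriv_eq]
  simp

/-- The differential of a (1,1)-form has only the types (2,1) and (1,2), on which pullback by `J` is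
multiplication by `i` and `-i`. Each part is therefore a combination of `dβ` and `J^*dβ` alone. -/
theorem typePart_extDeriv_apply (hJ : ∀ v, J (J v) = -v) (hd : DifferentiableAt ℝ β z)
    (hβ : ∀ᶠ y in 𝓝 z, ∀ a b, β y ![J a, J b] = β y ![a, b]) {p : ℕ} (hp : p < 4) (a b c : V) :
    typePart J p (extDeriv β z) ![a, b, c] = 1 / 2 * ((![0, 1, 1, 0] : Fin 4 → ℂ) ⟨p, hp⟩ *
      extDeriv β z ![a, b, c] + (![0, 1, -1, 0] : Fin 4 → ℂ) ⟨p, hp⟩ * Complex.I *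
      extDeriv β z ![J a, J b, J c]) := by
  rw [typePart_three_form J p hp]
  simp only [extDeriv_two_form hd, fderiv_left_eq_neg hJ hβ, hJ, map_right_neg, fderiv_fun_neg,
    neg_apply]
  interval_cases p <;> simp <;> ring

/-- The projections to types are orthogonal idempotents on the form at hand, so that only one
summand in the definition of `∂(∂̄β)` survives. -/
theorem typePart_typePart_extDeriv (hJ : ∀ v, J (J v) = -v) (hd : DifferentiableAt ℝ β z)
    (hβ : ∀ᶠ y in 𝓝 z, ∀ a b, β y ![J a, J b] = β y ![a, b]) {p : ℕ} (hp : p < 4) :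
    typePart J p (typePart J 1 (extDeriv β z)) =
      if p = 1 then typePart J 1 (extDeriv β z) else 0 := by
  have hγ : ∀ a b c, typePart J 1 (extDeriv β z) ![a, b, c] =
      1 / 2 * (extDeriv β z ![a, b, c] + Complex.I * extDeriv β z ![J a, J b, J c]) := by
    intro a b c
    simpa using typePart_extDeriv_apply hJ hd hβ (p := 1) (by norm_num) a b c
  ext v
  rw [show v = ![v 0, v 1, v 2] by funext i; fin_cases i <;> rfl, typePart_three_form J p hp,
    apply_ite (fun α : V [⋀^Fin 3]→L[ℝ] ℂ => α ![v 0, v 1, v 2])]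
  simp only [hγ, extDeriv_two_form hd, fderiv_left_eq_neg hJ hβ, hJ,
    map_left_neg, map_right_neg, fderiv_fun_neg, neg_apply, map_neg]
  interval_cases p <;> simp <;> ring_nf <;> simp only [Complex.I_sq] <;> ring

/-- The second derivative of `f` at `z` in the directions `q` and then `p`. -/
noncomputable def secondDeriv {G : Type*} [NormedAddCommGroup G] [NormedSpace ℝ G] (f : V → G)
    (z p q : V) : G :=
  fderiv ℝ (fun y => fderiv ℝ f y q) z p

section secondDeriv

variable {G : Type*} [NormedAddCommGroup G] [NormedSpace ℝ G] {f : V → G}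

theorem secondDeriv_eq (hf : ContDiffAt ℝ ∞ f z) (p q : V) :
    secondDeriv f z p q = fderiv ℝ (fderiv ℝ f) z p q := by
  have hd : DifferentiableAt ℝ (fderiv ℝ f) z :=
    (hf.fderiv_right (m := ∞) (by simp)).differentiableAt (by simp)
  rw [secondDeriv, fderiv_clm_apply hd (differentiableAt_const q)]
  simp

theorem secondDeriv_comm (hf : ContDiffAt ℝ ∞ f z) (p q : V) :
    secondDeriv f z p q = secondDeriv f z q p := by
  rw [secondDeriv_eq hf, secondDeriv_eq hf]
  exact hf.isSymmSndFDerivAt (by simpa using (ENat.LEInfty.out : (2 : WithTop ℕ∞) ≤ ∞)) p q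

theorem secondDeriv_neg_right (p q : V) : secondDeriv f z p (-q) = -secondDeriv f z p q := by
  simp [secondDeriv]

theorem secondDeriv_neg_left (p q : V) : secondDeriv f z (-p) q = -secondDeriv f z p q := by
  simp [secondDeriv]

theorem secondDeriv_neg (p q : V) :
    secondDeriv (fun y => -f y) z p q = -secondDeriv f z p q := by
  simp [secondDeriv, fderiv_fun_neg]

theorem Filter.EventuallyEq.secondDeriv_eq {g : V → G} (h : f =ᶠ[𝓝 z] g) (p q : V) :
    secondDeriv f z p q = secondDeriv g z p q := by
  unfold secondDeriv
  have : (fun y => fderiv ℝ f y q) =ᶠ[𝓝 z] fun y => fderiv ℝ g y q := by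
    filter_upwards [h.fderiv (𝕜 := ℝ)] with y hy
    rw [hy]
  rw [this.fderiv_eq]

end secondDeriv

theorem flatDel_typePart_extDeriv (hJ : ∀ v, J (J v) = -v)
    (hd : ∀ᶠ y in 𝓝 z, DifferentiableAt ℝ β y)
    (hβ : ∀ᶠ y in 𝓝 z, ∀ a b, β y ![J a, J b] = β y ![a, b]) :
    flatDel J (fun y => typePart J 1 (extDeriv β y)) z =
      typePart J 2 (extDeriv (fun y => typePart J 1 (extDeriv β y)) z) := by
  have h : ∀ p, p < 4 → (fun y => typePart J p (typePart J 1 (extDeriv β y))) =ᶠ[𝓝 z]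
      fun y => if p = 1 then typePart J 1 (extDeriv β y) else 0 := by
    intro p hp
    filter_upwards [hd, hβ.eventually_nhds] with y hy1 hy2
      using typePart_typePart_extDeriv hJ hy1 hy2 hp
  have h0 : extDeriv (fun _ : V => (0 : V [⋀^Fin 3]→L[ℝ] ℂ)) z = 0 := by
    rw [extDeriv, fderiv_fun_const]
    exact map_zero (ContinuousAlternatingMap.alternatizeUncurryFinCLM ℝ V ℂ)
  rw [flatDel, Finset.sum_range_succ, Finset.sum_range_succ, Finset.sum_range_succ,
    Finset.sum_range_one, (h 0 (by norm_num)).extDeriv_eq, (h 1 (by norm_num)).extDeriv_eq,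
    (h 2 (by norm_num)).extDeriv_eq, (h 3 (by norm_num)).extDeriv_eq]
  simp [h0]

/-- In `dβ(Jb, Jc, Jd)` the invariance of `β` removes `J` from the arguments of `β` and leaves it
only in the direction of differentiation. -/
theorem fderiv_typePart_extDeriv (hJ : ∀ v, J (J v) = -v)
    (hd : ∀ᶠ y in 𝓝 z, ContDiffAt ℝ ∞ β y)
    (hβ : ∀ᶠ y in 𝓝 z, ∀ a b, β y ![J a, J b] = β y ![a, b]) (a b c d : V) :
    fderiv ℝ (fun y => typePart J 1 (extDeriv β y) ![b, c, d]) z a =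
      1 / 2 * ((secondDeriv (fun y => β y ![c, d]) z a b
        - secondDeriv (fun y => β y ![b, d]) z a c + secondDeriv (fun y => β y ![b, c]) z a d)
      + Complex.I * (secondDeriv (fun y => β y ![c, d]) z a (J b)
        - secondDeriv (fun y => β y ![b, d]) z a (J c)
        + secondDeriv (fun y => β y ![b, c]) z a (J d))) := by
  have hev : (fun y => typePart J 1 (extDeriv β y) ![b, c, d]) =ᶠ[𝓝 z] fun y =>
      1 / 2 * ((fderiv ℝ (fun y => β y ![c, d]) y b
        - fderiv ℝ (fun y => β y ![b, d]) y c + fderiv ℝ (fun y => β y ![b, c]) y d)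
      + Complex.I * (fderiv ℝ (fun y => β y ![c, d]) y (J b)
        - fderiv ℝ (fun y => β y ![b, d]) y (J c)
        + fderiv ℝ (fun y => β y ![b, c]) y (J d))) := by
    filter_upwards [hd, hβ.eventually_nhds] with y hy1 hy2
    have hy := hy1.differentiableAt (by simp)
    have h1 : ∀ a b, fderiv ℝ (fun w => β w ![J a, J b]) y = fderiv ℝ (fun w => β w ![a, b]) y := by
      intro a b
      refine Filter.EventuallyEq.fderiv_eq ?_
      filter_upwards [hy2] with w hw using hw a b
    rw [typePart_extDeriv_apply hJ hy hy2 (by norm_num), extDeriv_two_form hy,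
      extDeriv_two_form hy, h1, h1, h1]
    simp
  have hdiff : ∀ p q r, DifferentiableAt ℝ (fun y => fderiv ℝ (fun y => β y ![p, q]) y r) z := by
    intro p q r
    have h1 := hd.self_of_nhds.continuousAlternatingMap_apply_const ![p, q]
    exact ((h1.fderiv_right (m := ∞) (by simp)).differentiableAt (by simp)).clm_apply
      (differentiableAt_const r)
  rw [hev.fderiv_eq]
  rw [fderiv_const_mul (by fun_prop), fderiv_fun_add (by fun_prop) (by fun_prop),
    fderiv_const_mul (by fun_prop), fderiv_fun_add (by fun_prop) (by fun_prop),
    fderiv_fun_sub (by fun_prop) (by fun_prop), fderiv_fun_add (by fun_prop) (by fun_prop),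
    fderiv_fun_sub (by fun_prop) (by fun_prop)]
  rfl

/-- The second order equation expressing that a form of type `(1,1)` is `∂∂̄`-closed. -/
theorem secondDeriv_identity [FiniteDimensional ℝ V] (hJ : ∀ v, J (J v) = -v)
    (hd : ∀ᶠ y in 𝓝 z, ContDiffAt ℝ ∞ β y)
    (hβ : ∀ᶠ y in 𝓝 z, ∀ a b, β y ![J a, J b] = β y ![a, b])
    (hclosed : flatDel J (flatDelbar J β) z = 0) (a b : V) :
    secondDeriv (fun y => β y ![b, J b]) z a a + secondDeriv (fun y => β y ![b, J b]) z (J a) (J a)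
      + secondDeriv (fun y => β y ![a, J a]) z b b
      + secondDeriv (fun y => β y ![a, J a]) z (J b) (J b)
      = 2 * (secondDeriv (fun y => β y ![a, J b]) z a b
        + secondDeriv (fun y => β y ![a, J b]) z (J a) (J b))
      - 2 * (secondDeriv (fun y => β y ![a, b]) z a (J b)
        - secondDeriv (fun y => β y ![a, b]) z (J a) b) := by
  have hd' : ∀ᶠ y in 𝓝 z, DifferentiableAt ℝ β y := by
    filter_upwards [hd] with y hy using hy.differentiableAt (by simp)
  have hγ : flatDelbar J β =ᶠ[𝓝 z] fun y => typePart J 1 (extDeriv β y) := by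
    filter_upwards [hβ.eventually_nhds] with y hy using flatDelbar_eq hJ hy
  have hγd : DifferentiableAt ℝ (fun y => typePart J 1 (extDeriv β y)) z :=
    (hd.self_of_nhds.extDeriv.typePart J 1).differentiableAt (by simp)
  rw [flatDel_congr hγ, flatDel_typePart_extDeriv hJ hd' hβ] at hclosed
  have hs : ∀ c d p q, secondDeriv (fun y => β y ![c, d]) z p q =
      secondDeriv (fun y => β y ![c, d]) z q p := fun c d p q =>
    secondDeriv_comm (hd.self_of_nhds.continuousAlternatingMap_apply_const ![c, d]) p q
  have hl : ∀ c d p q, secondDeriv (fun y => β y ![J c, d]) z p q =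
      -secondDeriv (fun y => β y ![c, J d]) z p q := by
    intro c d p q
    rw [← secondDeriv_neg]
    refine Filter.EventuallyEq.secondDeriv_eq ?_ p q
    filter_upwards [hβ] with y hy using map_left_eq_neg hJ hy c d
  have h0 : ∀ c p q, secondDeriv (fun y => β y ![c, c]) z p q = 0 := by
    intro c p q
    have : (fun y => β y ![c, c]) = fun _ => 0 := by
      funext y
      exact (β y).map_eq_zero_of_eq ![c, c] (i := 0) (j := 1) rfl (by decide)
    rw [this]
    simp [secondDeriv]
  -- Evaluating the (2,2)-form on the two complex lines through `a` and `b`.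
  have h := DFunLike.congr_fun hclosed ![a, J a, b, J b]
  rw [typePart_two_four_form] at h
  simp only [extDeriv_three_form hγd, fderiv_typePart_extDeriv hJ hd hβ, hJ, hl, map_neg,
    map_left_neg, map_right_neg, secondDeriv_neg, secondDeriv_neg_left, secondDeriv_neg_right,
    h0, hs _ _ (J a) a, hs _ _ b a, hs _ _ b (J a), hs _ _ (J b) a, hs _ _ (J b) (J a),
    hs _ _ (J b) b] at h
  rw [show (0 : V [⋀^Fin 4]→L[ℝ] ℂ) ![a, J a, b, J b] = 0 from rfl] at h
  -- The value of `∂∂̄β` on this frame is `-i/2` times the difference of the two sides.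
  refine sub_eq_zero.1 ((mul_eq_zero.1 (?_ : Complex.I * _ = 0)).resolve_left Complex.I_ne_zero)
  linear_combination -2 * h

end FlatPluriclosed

end FlatDolbeaultIdentity

/-! ### The holomorphic covering by `ℂ³ ∖ {0}` and its deck transformation -/

section UniversalCover

open scoped Topology ContDiff

namespace S5S1

/-- Multiplication by `i` on `ℂ³`. -/
noncomputable def mulI : C3 →L[ℝ] C3 :=
  (Complex.I • ContinuousLinearMap.id ℂ C3).restrictScalars ℝ

@[simp]
theorem mulI_apply (v : C3) : mulI v = Complex.I • v := rfl

theorem mulI_mulI (v : C3) : mulI (mulI v) = -v := by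
  simp [smul_smul]

/-- The exponent of the scaling factor in `hopfCover`. -/
noncomputable def coverExponent (τ : ℂ) : ℂ := (τ.re / τ.im : ℝ) * Complex.I - 1

/-- The lift of the first component of `hopfCover` to `ℂ³`. -/
noncomputable def coverVec (τ : ℂ) (z : C3) : C3 :=
  Complex.exp (coverExponent τ * Real.log ‖z‖) • z

theorem norm_coverVec (τ : ℂ) {z : C3} (hz : z ≠ 0) : ‖coverVec τ z‖ = 1 := by
  have hn : 0 < ‖z‖ := norm_pos_iff.2 hz
  rw [coverVec, norm_smul, Complex.norm_exp]
  have : (coverExponent τ * Real.log ‖z‖).re = -Real.log ‖z‖ := by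
    simp [coverExponent]
  rw [this, Real.exp_neg, Real.exp_log hn]
  exact inv_mul_cancel₀ hn.ne'

open Classical in
/-- The holomorphic covering `ℂ³ ∖ {0} → S⁵ × S¹`. -/
noncomputable def hopfCover (τ : ℂ) (z : C3) : S5S1 :=
  -- An arbitrary point of the sphere: the value at the origin plays no role, as all properties
  -- below that require it assume `z ≠ 0`.
  (if hz : z = 0 then ⟨EuclideanSpace.single 0 1, by simp⟩
    else ⟨coverVec τ z, by simpa using norm_coverVec τ hz⟩,
    Circle.exp (-(1 / τ.im) * Real.log ‖z‖))

theorem hopfCover_fst (τ : ℂ) {z : C3} (hz : z ≠ 0) : ((hopfCover τ z).1 : C3) = coverVec τ z := by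
  simp [hopfCover, hz]

theorem hopfCover_snd (τ : ℂ) (z : C3) :
    ((hopfCover τ z).2 : ℂ) = Complex.exp ((-(1 / τ.im) * Real.log ‖z‖ : ℝ) * Complex.I) :=
  Circle.coe_exp _

theorem hasFDerivAt_log_norm {z : C3} (hz : z ≠ 0) :
    HasFDerivAt (fun y : C3 => Real.log ‖y‖) ((‖z‖ ^ 2)⁻¹ • innerSL ℝ z) z := by
  have h1 : HasFDerivAt (fun y : C3 => ‖y‖ ^ 2) (2 • (innerSL ℝ z)) z :=
    (hasStrictFDerivAt_norm_sq z).hasFDerivAt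
  have h2 := (h1.log (by positivity)).const_mul (1 / 2 : ℝ)
  refine (h2.congr_of_eventuallyEq (Filter.Eventually.of_forall fun y => ?_)).congr_fderiv ?_
  · simp
  · ext v
    simp
    ring

theorem contDiffAt_log_norm {z : C3} (hz : z ≠ 0) :
    ContDiffAt ℝ ∞ (fun y : C3 => Real.log ‖y‖) z :=
  (contDiffAt_norm ℝ hz).log (by simpa using hz)

theorem contDiffAt_coverVec (τ : ℂ) {z : C3} (hz : z ≠ 0) : ContDiffAt ℝ ∞ (coverVec τ) z := by
  have h := (Complex.ofRealCLM.contDiff.contDiffAt.comp z (contDiffAt_log_norm hz))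
  have h2 : ContDiffAt ℝ ∞ (fun y : C3 => Complex.exp (coverExponent τ * Real.log ‖y‖)) z :=
    (contDiffAt_const.mul h).cexp
  exact h2.smul contDiffAt_id

theorem fderiv_coverVec (τ : ℂ) {z : C3} (hz : z ≠ 0) (v : C3) :
    fderiv ℝ (coverVec τ) z v = Complex.exp (coverExponent τ * Real.log ‖z‖) •
      ((coverExponent τ * ((inner ℂ z v).re / ‖z‖ ^ 2 : ℝ)) • z + v) := by
  have h := ((Complex.ofRealCLM.hasFDerivAt.comp z (hasFDerivAt_log_norm hz)).const_mul
    (coverExponent τ)).cexp.smul (hasFDerivAt_id z)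
  have := h.fderiv
  change fderiv ℝ (coverVec τ) z = _ at this
  rw [this]
  have hi : inner ℝ z v = (inner ℂ z v).re := rfl
  simp [hi, smul_smul, div_eq_inv_mul]
  module

theorem contMDiffAt_hopfCover (τ : ℂ) {z : C3} (hz : z ≠ 0) :
    ContMDiffAt 𝓘(ℝ, C3) model ∞ (hopfCover τ) z := by
  refine ContMDiffAt.prodMk ?_ ?_
  -- Restricting the codomain to the sphere needs a map with unit values everywhere on its domain,
  -- so smoothness is first shown on the open submanifold `ℂ³ ∖ {0}`.
  · let U : TopologicalSpace.Opens C3 := ⟨{0}ᶜ, isOpen_compl_singleton⟩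
    have key : ContMDiff 𝓘(ℝ, C3) (𝓡 5) ∞ (fun y : U => (hopfCover τ y).1) := by
      have hf : ContMDiff 𝓘(ℝ, C3) 𝓘(ℝ, C3) ∞ (fun y : U => coverVec τ y) := fun y =>
        contMDiffAt_subtype_iff.2 (contDiffAt_coverVec τ y.2).contMDiffAt
      have := hf.codRestrict_sphere (n := 5) (fun y => by simpa using norm_coverVec τ y.2)
      refine this.congr fun y => ?_
      exact Subtype.ext (hopfCover_fst τ y.2)
    exact contMDiffAt_subtype_iff (U := U) (f := fun y => (hopfCover τ y).1) (x := ⟨z, hz⟩) |>.1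
      (key ⟨z, hz⟩)
  · exact (contMDiff_circleExp.contMDiffAt).comp z
      ((contDiffAt_const.mul (contDiffAt_log_norm hz)).contMDiffAt)

theorem tangentFst_hopfCover (τ : ℂ) {z : C3} (hz : z ≠ 0) (v : C3) :
    tangentFst (hopfCover τ z) (mfderiv 𝓘(ℝ, C3) model (hopfCover τ) z v) =
      fderiv ℝ (coverVec τ) z v := by
  have hg : MDifferentiableAt model 𝓘(ℝ, C3) (fun y : S5S1 => (y.1 : C3)) (hopfCover τ z) :=
    ((contMDiff_coe_sphere (m := 1) _).comp _ contMDiffAt_fst).mdifferentiableAt one_ne_zero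
  have h := mfderiv_comp_apply z hg
    ((contMDiffAt_hopfCover τ hz).mdifferentiableAt (by simp)) v
  have heq : (fun y : S5S1 => (y.1 : C3)) ∘ hopfCover τ =ᶠ[𝓝 z] coverVec τ := by
    filter_upwards [isOpen_compl_singleton.mem_nhds hz] with y hy using hopfCover_fst τ hy
  rw [heq.mfderiv_eq, mfderiv_eq_fderiv] at h
  exact h.symm

theorem angleForm_hopfCover (τ : ℂ) {z : C3} (hz : z ≠ 0) (v : C3) :
    angleForm (hopfCover τ z) (mfderiv 𝓘(ℝ, C3) model (hopfCover τ) z v) =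
      -(1 / τ.im) * ((inner ℂ z v).re / ‖z‖ ^ 2) := by
  have hg : MDifferentiableAt model 𝓘(ℝ, ℂ) (fun y : S5S1 => (y.2 : ℂ)) (hopfCover τ z) := by
    have hc : MDifferentiableAt (𝓡 1) 𝓘(ℝ, ℂ) (fun w : Circle => (w : ℂ)) (hopfCover τ z).2 := by
      have := finrank_real_complex_fact'
      exact (contMDiff_coe_sphere (E := ℂ) (n := 1) (m := 1) _).mdifferentiableAt one_ne_zero
    exact hc.comp (hopfCover τ z) mdifferentiableAt_snd
  have h := mfderiv_comp_apply z hg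
    ((contMDiffAt_hopfCover τ hz).mdifferentiableAt (by simp)) v
  have heq : (fun y : S5S1 => (y.2 : ℂ)) ∘ hopfCover τ =
      fun y => Complex.exp ((-(1 / τ.im) * Real.log ‖y‖ : ℝ) * Complex.I) := by
    funext y; exact hopfCover_snd τ y
  have hd := ((Complex.ofRealCLM.hasFDerivAt.comp z
    ((hasFDerivAt_log_norm hz).const_mul (-(1 / τ.im)))).mul_const Complex.I).cexp
  rw [heq, mfderiv_eq_fderiv] at h
  have hd' := hd.fderiv
  change fderiv ℝ (fun y : C3 => Complex.exp ((-(1 / τ.im) * Real.log ‖y‖ : ℝ) * Complex.I)) z = _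
    at hd'
  rw [hd'] at h
  have hw : starRingEnd ℂ ((hopfCover τ z).2 : ℂ) * ((hopfCover τ z).2 : ℂ) = 1 := by
    rw [mul_comm, Complex.mul_conj, Circle.normSq_coe]; simp
  have hs : tangentSnd (hopfCover τ z) (mfderiv 𝓘(ℝ, C3) model (hopfCover τ) z v) =
      ((hopfCover τ z).2 : ℂ) * ((-(1 / τ.im) * ((inner ℂ z v).re / ‖z‖ ^ 2) : ℝ) * Complex.I) := by
    refine h.symm.trans ?_
    rw [hopfCover_snd]
    change Complex.exp ((-(1 / τ.im) * Real.log ‖z‖ : ℝ) * Complex.I) *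
      (Complex.I * ((-(1 / τ.im) * ((‖z‖ ^ 2)⁻¹ * (inner ℂ z v).re) : ℝ) : ℂ)) = _
    rw [div_eq_inv_mul]
    push_cast
    ring
  change (starRingEnd ℂ ((hopfCover τ z).2 : ℂ) * tangentSnd _ _).im = _
  rw [hs, ← mul_assoc, hw, one_mul, Complex.mul_I_im, Complex.ofReal_re]

theorem hopfForm_hopfCover (τ : ℂ) {z : C3} (hz : z ≠ 0) (v : C3) :
    hopfForm (hopfCover τ z) (mfderiv 𝓘(ℝ, C3) model (hopfCover τ) z v) =
      coverExponent τ * ((inner ℂ z v).re / ‖z‖ ^ 2 : ℝ) + inner ℂ z v / (‖z‖ ^ 2 : ℝ) := by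
  have hn : ‖z‖ ≠ 0 := norm_ne_zero_iff.2 hz
  have hzz : inner ℂ z z = ((‖z‖ ^ 2 : ℝ) : ℂ) := by
    rw [inner_self_eq_norm_sq_to_K]
    simp
  change inner ℂ ((hopfCover τ z).1 : C3) (tangentFst _ _) = _
  rw [tangentFst_hopfCover τ hz, fderiv_coverVec τ hz, hopfCover_fst τ hz, coverVec,
    inner_smul_left, inner_smul_right, inner_add_right, inner_smul_right,
    hzz, ← mul_assoc, ← Complex.normSq_eq_conj_mul_self,
    Complex.normSq_eq_norm_sq, Complex.norm_exp]
  have : (coverExponent τ * Real.log ‖z‖).re = -Real.log ‖z‖ := by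
    simp [coverExponent]
  rw [this, Real.exp_neg, Real.exp_log (norm_pos_iff.2 hz)]
  have hn' : (‖z‖ : ℂ) ≠ 0 := by exact_mod_cast hn
  push_cast
  field_simp

/-- Both components are complex linear in `v`, which is what makes the covering holomorphic. The
real part `-1` of `coverExponent` normalises `z`. Its imaginary part `Re τ / Im τ` and the factor
`-1 / Im τ` in the angle are the values for which `θ` pulls back to the (1,0)-form `-i ∂ log|z|²`.
-/
theorem coframe_hopfCover (τ : ℂ) (hτ : τ.im ≠ 0) {z : C3} (hz : z ≠ 0) (v : C3) :
    coframe τ (hopfCover τ z) (mfderiv 𝓘(ℝ, C3) model (hopfCover τ) z v) =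
      (Complex.exp (coverExponent τ * Real.log ‖z‖) •
        (v - (inner ℂ z v / (‖z‖ ^ 2 : ℝ)) • z), -Complex.I * (inner ℂ z v / (‖z‖ ^ 2 : ℝ))) := by
  refine Prod.ext ?_ ?_
  · change tangentFst _ _ - hopfForm _ _ • ((hopfCover τ z).1 : C3) = _
    rw [tangentFst_hopfCover τ hz, fderiv_coverVec τ hz, hopfCover_fst τ hz, coverVec,
      hopfForm_hopfCover τ hz]
    module
  · change theta τ _ _ = _
    rw [theta_apply, angleForm_hopfCover τ hz]
    change (((hopfForm _ _).im : ℝ) : ℂ) + _ = _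
    rw [hopfForm_hopfCover τ hz]
    generalize ‖z‖ ^ 2 = s
    generalize inner ℂ z v = c
    apply Complex.ext
    · simp [coverExponent]
      field_simp
      ring
    · simp [coverExponent]
      field_simp

theorem mfderiv_hopfCover_mulI (τ : ℂ) (hτ : τ.im ≠ 0) {z : C3} (hz : z ≠ 0) (v : C3) :
    mfderiv 𝓘(ℝ, C3) model (hopfCover τ) z (mulI v) =
      complexStructure τ (hopfCover τ z) (mfderiv 𝓘(ℝ, C3) model (hopfCover τ) z v) := by
  -- The coframe is injective and turns the complex structure into multiplication by `i`, so it is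
  -- enough to compare the two sides there.
  apply LinearMap.ker_eq_bot.1 (coframe_ker τ hτ (hopfCover τ z))
  change coframe τ (hopfCover τ z) (mfderiv 𝓘(ℝ, C3) model (hopfCover τ) z (mulI v)) =
    coframe τ (hopfCover τ z) _
  rw [coframe_complexStructure τ hτ, coframe_hopfCover τ hτ hz, coframe_hopfCover τ hτ hz,
    mulI_apply, inner_smul_right]
  refine Prod.ext ?_ ?_
  · simp only [Prod.smul_mk]
    module
  · simp only [Prod.smul_mk, smul_eq_mul]
    ring

theorem mfderiv_hopfCover_injective (τ : ℂ) (hτ : τ.im ≠ 0) {z : C3} (hz : z ≠ 0) (v : C3)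
    (hv : mfderiv 𝓘(ℝ, C3) model (hopfCover τ) z v = 0) : v = 0 := by
  have h := coframe_hopfCover τ hτ hz v
  rw [hv, map_zero] at h
  have h2 : inner ℂ z v / (‖z‖ ^ 2 : ℝ) = 0 := by
    simpa using (congrArg Prod.snd h).symm
  have h1 := (congrArg Prod.fst h).symm
  rw [h2] at h1
  simpa using h1

theorem isInvertible_mfderiv_hopfCover (τ : ℂ) (hτ : τ.im ≠ 0) {z : C3} (hz : z ≠ 0) :
    (mfderiv 𝓘(ℝ, C3) model (hopfCover τ) z).IsInvertible := by
  let L : C3 →ₗ[ℝ] (EuclideanSpace ℝ (Fin 5) × EuclideanSpace ℝ (Fin 1)) :=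
    (mfderiv 𝓘(ℝ, C3) model (hopfCover τ) z : C3 →L[ℝ] _).toLinearMap
  have hL : Function.Injective L :=
    LinearMap.ker_eq_bot.1 (LinearMap.ker_eq_bot'.2 (mfderiv_hopfCover_injective τ hτ hz))
  have hdim : Module.finrank ℝ C3 =
      Module.finrank ℝ (EuclideanSpace ℝ (Fin 5) × EuclideanSpace ℝ (Fin 1)) := by
    rw [finrank_C3_fact.out]
    simp
  refine ⟨(LinearEquiv.ofInjectiveOfFinrankEq L hL hdim).toContinuousLinearEquiv, ?_⟩
  ext v
  rfl

theorem isHolomorphicChartAt_hopfCover (τ : ℂ) (hτ : τ.im ≠ 0) {z : C3} (hz : z ≠ 0) :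
    IsHolomorphicChartAt mulI (complexStructure τ) (hopfCover τ) z where
  smooth := by
    filter_upwards [isOpen_compl_singleton.mem_nhds hz] with y hy using contMDiffAt_hopfCover τ hy
  invertible := isInvertible_mfderiv_hopfCover τ hτ hz
  comm := mfderiv_hopfCover_mulI τ hτ hz

/-- The generator of the deck group of `hopfCover`. -/
noncomputable def deckFactor (τ : ℂ) : ℂ :=
  Complex.exp (-coverExponent τ * (2 * Real.pi * |τ.im| : ℝ))

theorem norm_deckFactor (τ : ℂ) : ‖deckFactor τ‖ = Real.exp (2 * Real.pi * |τ.im|) := by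
  rw [deckFactor, Complex.norm_exp]
  congr 1
  simp [coverExponent]

theorem one_lt_norm_deckFactor (τ : ℂ) (hτ : τ.im ≠ 0) : 1 < ‖deckFactor τ‖ := by
  rw [norm_deckFactor, Real.one_lt_exp_iff]
  have := abs_pos.2 hτ
  positivity

theorem deckFactor_ne_zero (τ : ℂ) : deckFactor τ ≠ 0 := Complex.exp_ne_zero _

/-- Multiplication by `deckFactor` adds `2π|Im τ|` to `log|z|`. In the sphere the resulting
exponential cancels the factor itself, and in the circle the angle moves by one full turn. -/
theorem hopfCover_deckFactor (τ : ℂ) (hτ : τ.im ≠ 0) {z : C3} (hz : z ≠ 0) :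
    hopfCover τ (deckFactor τ • z) = hopfCover τ z := by
  have hlog : Real.log ‖deckFactor τ • z‖ = 2 * Real.pi * |τ.im| + Real.log ‖z‖ := by
    rw [norm_smul, Real.log_mul (by simpa using deckFactor_ne_zero τ) (by simpa using hz),
      norm_deckFactor, Real.log_exp]
  refine Prod.ext (Subtype.ext ?_) ?_
  · rw [hopfCover_fst τ hz, hopfCover_fst τ (smul_ne_zero (deckFactor_ne_zero τ) hz), coverVec,
      coverVec, hlog, smul_smul, deckFactor, ← Complex.exp_add]
    congr 2
    push_cast
    ring
  · change Circle.exp _ = Circle.exp _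
    rw [hlog, mul_add]
    -- The absolute value keeps the dilation expanding for either sign of `Im τ`, and the sign only
    -- decides the sense of the full turn.
    rcases abs_choice τ.im with h | h
    · rw [h, show -(1 / τ.im) * (2 * Real.pi * τ.im) = -(2 * Real.pi) by field_simp,
        Circle.exp_add, Circle.exp_neg, Circle.exp_two_pi]
      simp
    · rw [h, show -(1 / τ.im) * (2 * Real.pi * -τ.im) = 2 * Real.pi by field_simp,
        Circle.exp_add, Circle.exp_two_pi, one_mul]

/-- Chain rule applied to the identity of `hopfCover τ` with its composition with the deck
transformation, near `z`. -/
theorem pullback_hopfCover_deckFactor (τ : ℂ) (hτ : τ.im ≠ 0) {k : ℕ} (α : DiffForm model S5S1 k)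
    {z : C3} (hz : z ≠ 0) (v : Fin k → C3) :
    α.pullback (hopfCover τ) (deckFactor τ • z) (fun i => deckFactor τ • v i) =
      α.pullback (hopfCover τ) z v := by
  let m : C3 →L[ℝ] C3 := (deckFactor τ • ContinuousLinearMap.id ℂ C3).restrictScalars ℝ
  have heq : hopfCover τ ∘ m =ᶠ[𝓝 z] hopfCover τ := by
    filter_upwards [isOpen_compl_singleton.mem_nhds hz] with y hy using hopfCover_deckFactor τ hτ hy
  have hz' : m z ≠ 0 := smul_ne_zero (deckFactor_ne_zero τ) hz
  have hcomp := mfderiv_comp z ((contMDiffAt_hopfCover τ hz').mdifferentiableAt (by simp))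
    m.differentiableAt.mdifferentiableAt
  rw [heq.mfderiv_eq, mfderiv_eq_fderiv, m.fderiv] at hcomp
  have h := DiffForm.compContinuousLinearMap_congr (V := C3) α (hopfCover_deckFactor τ hτ hz)
    (L := ContinuousLinearMap.comp (M₂ := C3) (mfderiv 𝓘(ℝ, C3) model (hopfCover τ) (m z)) m)
    (L' := mfderiv 𝓘(ℝ, C3) model (hopfCover τ) z) hcomp.symm
  exact DFunLike.congr_fun h v

end S5S1

end UniversalCover

/-! ### Integration by parts against compactly supported functions -/

section RadialIntegrals

open scoped Topology ContDiff
open MeasureTheory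

section IntegrationByParts

variable {V : Type*} [NormedAddCommGroup V] [NormedSpace ℝ V]

theorem ContDiffAt.secondDeriv_continuousAt {G : Type*} [NormedAddCommGroup G] [NormedSpace ℝ G]
    {u : V → G} {z : V} (hu : ContDiffAt ℝ ∞ u z) (p q : V) :
    ContinuousAt (fun y => secondDeriv u y p q) z := by
  have h1 : ContDiffAt ℝ ∞ (fun y => fderiv ℝ u y q) z :=
    (hu.fderiv_right (m := ∞) (by simp)).clm_apply contDiffAt_const
  exact ((h1.fderiv_right (m := ∞) (by simp)).clm_apply contDiffAt_const).continuousAt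

theorem ContDiffAt.fderiv_apply_const {G : Type*} [NormedAddCommGroup G] [NormedSpace ℝ G]
    {u : V → G} {z : V} (hu : ContDiffAt ℝ ∞ u z) (q : V) :
    ContDiffAt ℝ ∞ (fun y => fderiv ℝ u y q) z :=
  (hu.fderiv_right (m := ∞) (by simp)).clm_apply contDiffAt_const

theorem continuous_smul_of_tsupport_subset {X G : Type*} [TopologicalSpace X]
    [NormedAddCommGroup G] [NormedSpace ℝ G] {φ : X → ℝ} {w : X → G}
    {U : Set X} (hφ : Continuous φ) (hφU : tsupport φ ⊆ U) (hw : ∀ y ∈ U, ContinuousAt w y) :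
    Continuous (fun y => φ y • w y) := by
  refine continuous_of_tsupport fun x hx => ?_
  exact hφ.continuousAt.smul (hw x (hφU (tsupport_smul_subset_left φ w hx)))

theorem integrable_smul_of_tsupport_subset {X G : Type*} [TopologicalSpace X] [T2Space X]
    [NormedAddCommGroup G] [NormedSpace ℝ G]
    [MeasurableSpace X] [OpensMeasurableSpace X] {μ : Measure X} [IsFiniteMeasureOnCompacts μ]
    {φ : X → ℝ} {w : X → G} {U : Set X} (hφ : Continuous φ) (hc : HasCompactSupport φ)
    (hφU : tsupport φ ⊆ U)
    (hw : ∀ y ∈ U, ContinuousAt w y) :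
    Integrable (fun y => φ y • w y) μ :=
  (continuous_smul_of_tsupport_subset hφ hφU hw).integrable_of_hasCompactSupport
    (hc.smul_right)

variable [MeasurableSpace V] [BorelSpace V] {μ : Measure V} [μ.IsAddHaarMeasure]

/-- Two integrations by parts. Smoothness of `u` is needed only on a set containing the support of
`ψ`, since the forms to which this is applied are controlled only off the origin. -/
theorem integral_smul_secondDeriv [FiniteDimensional ℝ V] {ψ : V → ℝ} {u : V → ℂ} {U : Set V}
    (hψ : ContDiff ℝ ∞ ψ) (hc : HasCompactSupport ψ) (hψU : tsupport ψ ⊆ U)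
    (hu : ∀ y ∈ U, ContDiffAt ℝ ∞ u y) (p q : V) :
    ∫ y, ψ y • secondDeriv u y p q ∂μ = ∫ y, secondDeriv ψ y p q • u y ∂μ := by
  have hψ1 : ∀ p, ContDiff ℝ ∞ (fun y => fderiv ℝ ψ y p) := fun p =>
    (hψ.fderiv_right (m := ∞) (by simp)).clm_apply contDiff_const
  have hs1 : ∀ p, tsupport (fun y => fderiv ℝ ψ y p) ⊆ U := fun p =>
    (tsupport_fderiv_apply_subset ℝ p).trans hψU
  have hc1 : ∀ p, HasCompactSupport (fun y => fderiv ℝ ψ y p) := fun p =>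
    hc.fderiv_apply ℝ p
  have hu0 : ∀ y ∈ U, ContinuousAt u y := fun y hy => (hu y hy).continuousAt
  have hu1 : ∀ y ∈ U, ContinuousAt (fun y => fderiv ℝ u y q) y := fun y hy =>
    ((hu y hy).fderiv_apply_const q).continuousAt
  have hψ2 : Continuous (fun y => secondDeriv ψ y q p) :=
    ((hψ1 p).fderiv_right (m := ∞) (by simp)).continuous.clm_apply continuous_const
  have h1 : ∫ y, ψ y • secondDeriv u y p q ∂μ =
      -∫ y, fderiv ℝ ψ y p • fderiv ℝ u y q ∂μ := by
    refine integral_smul_fderiv_eq_neg_fderiv_smul_of_integrable ?_ ?_ ?_ ?_ ?_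
    · exact integrable_smul_of_tsupport_subset (hψ1 p).continuous (hc1 p) (hs1 p) hu1
    · exact integrable_smul_of_tsupport_subset hψ.continuous hc hψU
        fun y hy => (hu y hy).secondDeriv_continuousAt p q
    · exact integrable_smul_of_tsupport_subset hψ.continuous hc hψU hu1
    · exact fun x _ => hψ.differentiable (by simp) x
    · exact fun x hx => ((hu x (hψU hx)).fderiv_apply_const q).differentiableAt (by simp)
  have h2 : ∫ y, fderiv ℝ ψ y p • fderiv ℝ u y q ∂μ =
      -∫ y, secondDeriv ψ y q p • u y ∂μ := by
    refine integral_smul_fderiv_eq_neg_fderiv_smul_of_integrable ?_ ?_ ?_ ?_ ?_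
    · exact integrable_smul_of_tsupport_subset hψ2 ((hc1 p).fderiv_apply ℝ q)
        ((tsupport_fderiv_apply_subset ℝ q).trans (hs1 p)) hu0
    · exact integrable_smul_of_tsupport_subset (hψ1 p).continuous (hc1 p) (hs1 p) hu1
    · exact integrable_smul_of_tsupport_subset (hψ1 p).continuous (hc1 p) (hs1 p) hu0
    · exact fun x _ => (hψ1 p).differentiable (by simp) x
    · exact fun x hx => (hu x (hs1 p hx)).differentiableAt (by simp)
  rw [h1, h2, neg_neg]
  refine integral_congr_ae (Filter.Eventually.of_forall fun y => ?_)
  simp only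
  rw [secondDeriv_comm hψ.contDiffAt]

theorem integrable_secondDeriv_smul {ψ : V → ℝ} {u : V → ℂ} {U : Set V}
    (hψ : ContDiff ℝ ∞ ψ) (hc : HasCompactSupport ψ) (hψU : tsupport ψ ⊆ U)
    (hu : ∀ y ∈ U, ContDiffAt ℝ ∞ u y) (p q : V) :
    Integrable (fun y => secondDeriv ψ y p q • u y) μ := by
  refine integrable_smul_of_tsupport_subset (U := U) ?_ ?_ ?_ fun y hy => (hu y hy).continuousAt
  · exact (((hψ.fderiv_right (m := ∞) (by simp)).clm_apply contDiff_const).fderiv_right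
      (m := ∞) (by simp)).continuous.clm_apply continuous_const
  · exact (hc.fderiv_apply ℝ q).fderiv_apply ℝ p
  · exact ((tsupport_fderiv_apply_subset ℝ p).trans (tsupport_fderiv_apply_subset ℝ q)).trans hψU

end IntegrationByParts

section Radial

variable {V : Type*} [NormedAddCommGroup V] [InnerProductSpace ℝ V]

theorem secondDeriv_radial {P : ℝ → ℝ} (hP : ContDiff ℝ ∞ P) (z p q : V) :
    secondDeriv (fun y : V => P (‖y‖ ^ 2)) z p q =
      4 * deriv (deriv P) (‖z‖ ^ 2) * (inner ℝ z p * inner ℝ z q)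
        + 2 * deriv P (‖z‖ ^ 2) * inner ℝ p q := by
  have hn : ∀ y : V, HasFDerivAt (fun y : V => ‖y‖ ^ 2) (2 • innerSL ℝ y) y := fun y =>
    (hasStrictFDerivAt_norm_sq y).hasFDerivAt
  have hP' : ContDiff ℝ ∞ (deriv P) := (contDiff_infty_iff_deriv.1 hP).2
  have h1 : (fun y => fderiv ℝ (fun y : V => P (‖y‖ ^ 2)) y q) =
      fun y => deriv P (‖y‖ ^ 2) * (2 * inner ℝ q y) := by
    funext y
    have := ((hP.differentiable (by simp) (‖y‖ ^ 2)).hasDerivAt.comp_hasFDerivAt y (hn y)).fderiv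
    change fderiv ℝ (fun y : V => P (‖y‖ ^ 2)) y = _ at this
    rw [this]
    simp [real_inner_comm]
  rw [secondDeriv, h1]
  have h2 := ((hP'.differentiable (by simp) (‖z‖ ^ 2)).hasDerivAt.comp_hasFDerivAt z (hn z)).mul
    (((innerSL ℝ q).hasFDerivAt (x := z)).const_mul 2)
  have h3 := h2.fderiv
  change fderiv ℝ (fun y => deriv P (‖y‖ ^ 2) * (2 * inner ℝ q y)) z = _ at h3
  rw [h3]
  simp [real_inner_comm]
  ring

end Radial

/-! ### The pluriclosed equation tested against radial functions on `ℂ³` -/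

section FlatIdentity

namespace S5S1

/-- The standard basis of `ℂ³`. -/
noncomputable def stdVec (a : Fin 3) : C3 := EuclideanSpace.single a 1

theorem inner_stdVec (z : C3) (a : Fin 3) : inner ℝ z (stdVec a) = (z a).re := by
  change (inner ℂ z (stdVec a)).re = _
  rw [stdVec, EuclideanSpace.inner_single_right]
  simp

theorem inner_mulI_stdVec (z : C3) (a : Fin 3) : inner ℝ z (mulI (stdVec a)) = (z a).im := by
  change (inner ℂ z (Complex.I • stdVec a)).re = _
  rw [inner_smul_right, stdVec, EuclideanSpace.inner_single_right]
  simp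

theorem stdVec_apply (a b : Fin 3) : stdVec a b = if b = a then 1 else 0 := by
  simp [stdVec]

theorem norm_sq_eq (z : C3) : ‖z‖ ^ 2 = ∑ a, ((z a).re ^ 2 + (z a).im ^ 2) := by
  rw [EuclideanSpace.norm_sq_eq]
  refine Finset.sum_congr rfl fun a _ => ?_
  rw [← Complex.normSq_eq_norm_sq, Complex.normSq_apply]
  ring

theorem eq_sum_stdVec (z : C3) :
    z = ∑ a, ((z a).re • stdVec a + (z a).im • mulI (stdVec a)) := by
  ext b
  simp only [WithLp.ofLp_sum, Finset.sum_apply, WithLp.ofLp_add, Pi.add_apply, PiLp.smul_apply,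
    mulI_apply, stdVec_apply]
  rw [Finset.sum_eq_single b (by intro a _ hab; simp [hab.symm]) (by simp)]
  simp [Complex.re_add_im]

end S5S1

section Bilinear

variable {V : Type*} [NormedAddCommGroup V] [NormedSpace ℝ V]

theorem update_vec_zero {X : Type*} (a b c : X) : Function.update ![a, b] 0 c = ![c, b] := by
  funext i; fin_cases i <;> rfl

theorem update_vec_one {X : Type*} (a b c : X) : Function.update ![a, b] 1 c = ![a, c] := by
  funext i; fin_cases i <;> rfl

/-- A two-form as a bilinear map. -/
noncomputable def twoFormBilin (α : V [⋀^Fin 2]→L[ℝ] ℂ) : V →ₗ[ℝ] V →ₗ[ℝ] ℂ :=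
  LinearMap.mk₂ ℝ (fun a b => α ![a, b])
    (fun a a' b => by
      have := α.toAlternatingMap.map_update_add ![a, b] 0 a a'
      rwa [update_vec_zero, update_vec_zero, update_vec_zero] at this)
    (fun c a b => by
      have := α.toAlternatingMap.map_update_smul ![a, b] 0 c a
      rwa [update_vec_zero, update_vec_zero] at this)
    (fun a b b' => by
      have := α.toAlternatingMap.map_update_add ![a, b] 1 b b'
      rwa [update_vec_one, update_vec_one, update_vec_one] at this)
    (fun c a b => by
      have := α.toAlternatingMap.map_update_smul ![a, b] 1 c b
      rwa [update_vec_one, update_vec_one] at this)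

theorem twoFormBilin_apply (α : V [⋀^Fin 2]→L[ℝ] ℂ) (a b : V) :
    twoFormBilin α a b = α ![a, b] := rfl

end Bilinear

namespace S5S1

/-- Besides entering the trace computation, this expansion with fixed vectors inside `α` gives the
continuity of `z ↦ β_z(z, iz)`. -/
theorem apply_self_mulI {α : C3 [⋀^Fin 2]→L[ℝ] ℂ}
    (hα : ∀ a b, α ![mulI a, mulI b] = α ![a, b]) (z : C3) :
    α ![z, mulI z] = ∑ a, ∑ b,
      (((z a).re * (z b).re + (z a).im * (z b).im : ℝ) * α ![stdVec a, mulI (stdVec b)]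
        - ((z a).re * (z b).im - (z a).im * (z b).re : ℝ) * α ![stdVec a, stdVec b]) := by
  have hJz : mulI z = ∑ b, ((z b).re • mulI (stdVec b) - (z b).im • stdVec b) := by
    conv_lhs => rw [eq_sum_stdVec z]
    rw [map_sum]
    refine Finset.sum_congr rfl fun b _ => ?_
    rw [map_add, map_smul, map_smul, mulI_mulI, smul_neg, sub_eq_add_neg]
  have hz : twoFormBilin α z =
      ∑ a, twoFormBilin α ((z a).re • stdVec a + (z a).im • mulI (stdVec a)) := by
    conv_lhs => rw [eq_sum_stdVec z]
    rw [map_sum]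
  rw [← twoFormBilin_apply, hJz, hz, LinearMap.sum_apply]
  refine Finset.sum_congr rfl fun a _ => ?_
  rw [map_sum]
  refine Finset.sum_congr rfl fun b _ => ?_
  simp only [map_add, map_sub, map_smul, LinearMap.add_apply, LinearMap.smul_apply,
    twoFormBilin_apply, hα, map_left_eq_neg mulI_mulI hα, Complex.real_smul]
  push_cast
  ring

/-- Summing over pairs of coordinate lines amounts to wedging with the Euclidean Kähler form: it
produces the trace of the complex Hessian times the trace of `α`, minus their contraction. That
Hessian is `P₁` times the identity plus `P₂` times a rank one matrix with entries `z̄_a z_b`. The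
coefficient 2 of `P₁` is thus 3 - 1. -/
theorem secondDeriv_sum_identity (P₁ P₂ : ℝ) {α : C3 [⋀^Fin 2]→L[ℝ] ℂ}
    (hα : ∀ a b, α ![mulI a, mulI b] = α ![a, b]) (z : C3) (h : C3 → C3 → ℝ)
    (hh : ∀ p q, h p q = 4 * P₂ * (inner ℝ z p * inner ℝ z q) + 2 * P₁ * inner ℝ p q) :
    ∑ a, ∑ b, (h (stdVec a) (stdVec a) • α ![stdVec b, mulI (stdVec b)]
        + h (mulI (stdVec a)) (mulI (stdVec a)) • α ![stdVec b, mulI (stdVec b)]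
        + h (stdVec b) (stdVec b) • α ![stdVec a, mulI (stdVec a)]
        + h (mulI (stdVec b)) (mulI (stdVec b)) • α ![stdVec a, mulI (stdVec a)]
        - 2 * (h (stdVec a) (stdVec b) • α ![stdVec a, mulI (stdVec b)]
          + h (mulI (stdVec a)) (mulI (stdVec b)) • α ![stdVec a, mulI (stdVec b)])
        + 2 * (h (stdVec a) (mulI (stdVec b)) • α ![stdVec a, stdVec b]
          - h (mulI (stdVec a)) (stdVec b) • α ![stdVec a, stdVec b])) =
      8 * ((‖z‖ ^ 2 * P₂ + 2 * P₁ : ℝ) * ∑ a, α ![stdVec a, mulI (stdVec a)]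
        - P₂ * α ![z, mulI z]) := by
  have hI : ∀ a b : Fin 3, (mulI (stdVec a)) b = if b = a then Complex.I else 0 := by
    intro a b
    simp [stdVec_apply]
  rw [apply_self_mulI hα]
  simp only [hh, inner_stdVec, inner_mulI_stdVec, norm_sq_eq, Fin.sum_univ_three, hI, stdVec_apply,
    Complex.real_smul]
  simp
  ring

variable {β : C3 → C3 [⋀^Fin 2]→L[ℝ] ℂ}

/-- The equation `∂∂̄β = 0` tested against a radial function. -/
theorem integral_radial_eq_zero (hs : ∀ z ≠ 0, ContDiffAt ℝ ∞ β z)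
    (hβ : ∀ z ≠ 0, ∀ a b, β z ![mulI a, mulI b] = β z ![a, b])
    (hcl : ∀ z ≠ 0, flatDel mulI (flatDelbar mulI β) z = 0)
    {P : ℝ → ℝ} (hP : ContDiff ℝ ∞ P) {r R : ℝ} (hr : 0 < r)
    (hPr : ∀ s < r, P s = 0) (hPR : ∀ s > R, P s = 0) :
    ∫ z, ((‖z‖ ^ 2 * deriv (deriv P) (‖z‖ ^ 2) + 2 * deriv P (‖z‖ ^ 2) : ℝ) *
        (∑ a, β z ![stdVec a, mulI (stdVec a)])
      - (deriv (deriv P) (‖z‖ ^ 2) : ℝ) * β z ![z, mulI z]) = 0 := by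
  set ψ : C3 → ℝ := fun z => P (‖z‖ ^ 2) with hψdef
  have hψ : ContDiff ℝ ∞ ψ := hP.comp (contDiff_norm_sq ℝ)
  have hsupp : tsupport ψ ⊆ {z : C3 | r ≤ ‖z‖ ^ 2 ∧ ‖z‖ ^ 2 ≤ R} := by
    refine closure_minimal ?_ ?_
    · intro z hz
      constructor
      · by_contra h
        exact hz (hPr _ (not_le.1 h))
      · by_contra h
        exact hz (hPR _ (not_le.1 h))
    · exact (isClosed_le continuous_const (continuous_norm.pow 2)).inter
        (isClosed_le (continuous_norm.pow 2) continuous_const)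
  have hU : tsupport ψ ⊆ {0}ᶜ := by
    intro z hz h0
    rw [Set.mem_singleton_iff] at h0
    have := (hsupp hz).1
    rw [h0] at this
    simp at this
    linarith
  have hc : HasCompactSupport ψ := by
    refine HasCompactSupport.of_support_subset_isCompact
      (isCompact_closedBall (0 : C3) (Real.sqrt R)) ?_
    intro z hz
    rw [mem_closedBall_zero_iff]
    exact Real.le_sqrt_of_sq_le (hsupp (subset_tsupport _ hz)).2
  have hW : ∀ p q, ∀ y ∈ ({0}ᶜ : Set C3), ContDiffAt ℝ ∞ (fun y => β y ![p, q]) y :=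
    fun p q y hy => (hs y hy).continuousAlternatingMap_apply_const ![p, q]
  have hi1 : ∀ p q c d, Integrable (fun y => secondDeriv ψ y p q • β y ![c, d]) :=
    fun p q c d => integrable_secondDeriv_smul hψ hc hU (hW c d) p q
  have hi2 : ∀ p q c d, Integrable (fun y => ψ y • secondDeriv (fun y => β y ![c, d]) y p q) :=
    fun p q c d => integrable_smul_of_tsupport_subset hψ.continuous hc hU
      fun y hy => (hW c d y hy).secondDeriv_continuousAt p q
  -- Integrability is carried along with the vanishing integral so that the property is closed under
  -- the linear combinations below.
  let Z : (C3 → ℂ) → Prop := fun f => Integrable f ∧ ∫ y, f y = 0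
  have hadd : ∀ {f g : C3 → ℂ}, Z f → Z g → Z (fun y => f y + g y) := fun hf hg =>
    ⟨hf.1.add hg.1, by rw [integral_add hf.1 hg.1, hf.2, hg.2, add_zero]⟩
  have hsub : ∀ {f g : C3 → ℂ}, Z f → Z g → Z (fun y => f y - g y) := fun hf hg =>
    ⟨hf.1.sub hg.1, by rw [integral_sub hf.1 hg.1, hf.2, hg.2, sub_zero]⟩
  have hmul : ∀ {f : C3 → ℂ}, Z f → Z (fun y => 2 * f y) := fun hf =>
    ⟨hf.1.const_mul 2, by rw [integral_const_mul, hf.2, mul_zero]⟩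
  have hD : ∀ p q c d, Z (fun y => secondDeriv ψ y p q • β y ![c, d]
      - ψ y • secondDeriv (fun y => β y ![c, d]) y p q) := fun p q c d =>
    ⟨(hi1 p q c d).sub (hi2 p q c d), by
      rw [integral_sub (hi1 p q c d) (hi2 p q c d), integral_smul_secondDeriv hψ hc hU (hW c d),
        sub_self]⟩
  have hψ0 : ψ 0 = 0 := hPr _ (by simpa using hr)
  have hψ2 : ∀ p q, secondDeriv ψ 0 p q = 0 := by
    intro p q
    have : ψ =ᶠ[𝓝 0] fun _ => 0 := notMem_tsupport_iff_eventuallyEq.1 fun h => hU h rfl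
    rw [this.secondDeriv_eq]
    simp [secondDeriv]
  have hT : ∀ a b : C3, Z (fun y => secondDeriv ψ y a a • β y ![b, mulI b]
        + secondDeriv ψ y (mulI a) (mulI a) • β y ![b, mulI b]
        + secondDeriv ψ y b b • β y ![a, mulI a]
        + secondDeriv ψ y (mulI b) (mulI b) • β y ![a, mulI a]
        - 2 * (secondDeriv ψ y a b • β y ![a, mulI b]
          + secondDeriv ψ y (mulI a) (mulI b) • β y ![a, mulI b])
        + 2 * (secondDeriv ψ y a (mulI b) • β y ![a, b]
          - secondDeriv ψ y (mulI a) b • β y ![a, b])) := by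
    intro a b
    -- The same combination of the terms with derivatives on `β` is `ψ` times the pluriclosed
    -- equation, hence vanishes pointwise, and only the terms with derivatives on `ψ` remain.
    have h := hadd (hsub (hadd (hadd (hadd (hD a a b (mulI b)) (hD (mulI a) (mulI a) b (mulI b)))
      (hD b b a (mulI a))) (hD (mulI b) (mulI b) a (mulI a)))
      (hmul (hadd (hD a b a (mulI b)) (hD (mulI a) (mulI b) a (mulI b)))))
      (hmul (hsub (hD a (mulI b) a b) (hD (mulI a) b a b)))
    convert h using 2 with y
    rcases eq_or_ne y 0 with rfl | hy
    · simp [hψ0, hψ2]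
    · have hy' := isOpen_compl_singleton.mem_nhds hy
      have hpde := secondDeriv_identity mulI_mulI (z := y) (β := β)
        (by filter_upwards [hy'] with w hw using hs w hw)
        (by filter_upwards [hy'] with w hw using hβ w hw) (hcl y hy) a b
      simp only [Complex.real_smul]
      linear_combination (ψ y : ℂ) * hpde
  have hsum : ∫ y, ∑ a, ∑ b, (secondDeriv ψ y (stdVec a) (stdVec a) •
          β y ![stdVec b, mulI (stdVec b)]
        + secondDeriv ψ y (mulI (stdVec a)) (mulI (stdVec a)) • β y ![stdVec b, mulI (stdVec b)]
        + secondDeriv ψ y (stdVec b) (stdVec b) • β y ![stdVec a, mulI (stdVec a)]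
        + secondDeriv ψ y (mulI (stdVec b)) (mulI (stdVec b)) • β y ![stdVec a, mulI (stdVec a)]
        - 2 * (secondDeriv ψ y (stdVec a) (stdVec b) • β y ![stdVec a, mulI (stdVec b)]
          + secondDeriv ψ y (mulI (stdVec a)) (mulI (stdVec b)) • β y ![stdVec a, mulI (stdVec b)])
        + 2 * (secondDeriv ψ y (stdVec a) (mulI (stdVec b)) • β y ![stdVec a, stdVec b]
          - secondDeriv ψ y (mulI (stdVec a)) (stdVec b) • β y ![stdVec a, stdVec b])) = 0 := by
    rw [integral_finsetSum _ fun a _ => integrable_finsetSum _ fun b _ =>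
      (hT (stdVec a) (stdVec b)).1]
    refine Finset.sum_eq_zero fun a _ => ?_
    rw [integral_finsetSum _ fun b _ => (hT (stdVec a) (stdVec b)).1]
    exact Finset.sum_eq_zero fun b _ => (hT (stdVec a) (stdVec b)).2
  refine (mul_eq_zero.1 (?_ : (8 : ℂ) * _ = 0)).resolve_left (by norm_num)
  rw [← integral_const_mul, ← hsum]
  refine integral_congr_ae ?_
  have h0 : ∀ᵐ y : C3, y ≠ 0 := by
    rw [ae_iff]
    simp
  filter_upwards [h0] with y hy
  exact (secondDeriv_sum_identity (deriv P (‖y‖ ^ 2)) (deriv (deriv P) (‖y‖ ^ 2)) (hβ y hy) y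
      (fun p q => secondDeriv ψ y p q) (fun p q => secondDeriv_radial hP y p q)).symm

end S5S1

end FlatIdentity

end RadialIntegrals

/-! ### Radial weights, scaling of integrals and the cutoff functions -/

section Weights

open scoped Topology ContDiff
open MeasureTheory

namespace S5S1

section Scaling

/-- A continuous weight on `ℝ` supported in a compact subset of `[1, ∞)`. -/
structure IsWeight (η : ℝ → ℝ) : Prop where
  continuous : Continuous η
  eq_zero_of_lt_one : ∀ s < 1, η s = 0
  exists_bound : ∃ R, ∀ s > R, η s = 0

theorem IsWeight.comp_div {η : ℝ → ℝ} (hη : IsWeight η) {q : ℝ} (hq : 1 < q) :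
    IsWeight (fun s => η (s / q)) where
  continuous := hη.continuous.comp (continuous_id.div_const q)
  eq_zero_of_lt_one s hs := by
    refine hη.eq_zero_of_lt_one _ ?_
    rw [div_lt_one (by linarith)]
    linarith
  exists_bound := by
    obtain ⟨R, hR⟩ := hη.exists_bound
    refine ⟨R * q, fun s hs => hR _ ?_⟩
    rw [gt_iff_lt, lt_div_iff₀ (by linarith)]
    exact hs

theorem IsWeight.integrable {η : ℝ → ℝ} (hη : IsWeight η) {g : C3 → ℝ}
    (hg : ∀ z ≠ 0, ContinuousAt g z) : Integrable (fun z : C3 => η (‖z‖ ^ 2) * g z) := by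
  obtain ⟨R, hR⟩ := hη.exists_bound
  have hsupp : tsupport (fun z : C3 => η (‖z‖ ^ 2)) ⊆ {z : C3 | 1 ≤ ‖z‖ ^ 2 ∧ ‖z‖ ^ 2 ≤ R} := by
    refine closure_minimal ?_ ?_
    · intro z hz
      constructor
      · by_contra h
        exact hz (hη.eq_zero_of_lt_one _ (not_le.1 h))
      · by_contra h
        exact hz (hR _ (not_le.1 h))
    · exact (isClosed_le continuous_const (continuous_norm.pow 2)).inter
        (isClosed_le (continuous_norm.pow 2) continuous_const)
  refine integrable_smul_of_tsupport_subset (U := {0}ᶜ)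
    (hη.continuous.comp (continuous_norm.pow 2)) ?_ ?_ fun y hy => hg y hy
  · refine HasCompactSupport.of_support_subset_isCompact
      (isCompact_closedBall (0 : C3) (Real.sqrt R)) ?_
    intro z hz
    rw [mem_closedBall_zero_iff]
    exact Real.le_sqrt_of_sq_le (hsupp (subset_tsupport _ hz)).2
  · intro z hz h0
    rw [Set.mem_singleton_iff] at h0
    have := (hsupp hz).1
    rw [h0] at this
    norm_num at this

/-- Multiplication by `c` is a unitary rotation by `c/|c|` followed by a real dilation in real
dimension 6. -/
theorem integral_comp_complex_smul (c : ℂ) (hc : c ≠ 0) (g : C3 → ℝ) :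
    ∫ z : C3, g (c • z) = (‖c‖ ^ 6)⁻¹ * ∫ z : C3, g z := by
  have hn : ‖c‖ ≠ 0 := norm_ne_zero_iff.2 hc
  set u : ℂ := c / ‖c‖ with hu
  have hu1 : ‖u‖ = 1 := by simp [hu, hn]
  have hu0 : u ≠ 0 := by rw [← norm_ne_zero_iff, hu1]; exact one_ne_zero
  let e : C3 ≃ₗᵢ[ℝ] C3 :=
    { toLinearEquiv := (LinearEquiv.smulOfNeZero ℂ C3 u hu0).restrictScalars ℝ
      norm_map' := fun v => by
        change ‖u • v‖ = ‖v‖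
        rw [norm_smul, hu1, one_mul] }
  have h1 := e.measurePreserving.integral_comp e.toHomeomorph.measurableEmbedding
    (fun z => g (‖c‖ • z))
  have h2 := Measure.integral_comp_smul (volume : Measure C3) g ‖c‖
  rw [h2, finrank_C3_fact.out, abs_of_nonneg (by positivity), smul_eq_mul] at h1
  rw [← h1]
  congr 1
  funext z
  change g (c • z) = g (‖c‖ • (u • z))
  congr 1
  rw [hu, ← Complex.coe_smul, smul_smul, mul_div_cancel₀]
  exact_mod_cast hn

/-- The behaviour of a radially weighted integral of a function that is homogeneous under a
dilation by `c`. -/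
theorem integral_weight_comp_div {c : ℂ} (hc : 1 < ‖c‖) {g : C3 → ℝ} {k : ℝ}
    (hg : ∀ z ≠ 0, g z = k * g (c • z)) (η : ℝ → ℝ) :
    ‖c‖ ^ 6 * ∫ z : C3, η (‖z‖ ^ 2) * g z =
      k * ∫ z : C3, η (‖z‖ ^ 2 / ‖c‖ ^ 2) * g z := by
  have hn : ‖c‖ ≠ 0 := by linarith
  have hc0 : c ≠ 0 := norm_ne_zero_iff.1 hn
  have h := integral_comp_complex_smul c hc0 (fun z => η (‖z‖ ^ 2 / ‖c‖ ^ 2) * g z)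
  have h2 : ∫ z : C3, η (‖z‖ ^ 2) * g z =
      k * ∫ z : C3, η (‖c • z‖ ^ 2 / ‖c‖ ^ 2) * g (c • z) := by
    rw [← integral_const_mul]
    refine integral_congr_ae ?_
    have h0 : ∀ᵐ y : C3, y ≠ 0 := by
      rw [ae_iff]
      simp
    filter_upwards [h0] with y hy
    rw [norm_smul, mul_pow, mul_div_cancel_left₀ _ (by positivity), hg y hy]
    ring
  rw [h2, h]
  field_simp

/-- The singularity at 0 is harmless because `h` vanishes around it. -/
theorem contDiff_inv_pow_mul {h : ℝ → ℝ} (hh : ContDiff ℝ ∞ h) (h0 : ∀ s < 1, h s = 0) (k : ℕ) :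
    ContDiff ℝ ∞ (fun s => (s ^ k)⁻¹ * h s) := by
  rw [contDiff_iff_contDiffAt]
  intro s
  rcases lt_or_ge s 1 with hs | hs
  · refine (contDiffAt_const (c := (0 : ℝ))).congr_of_eventuallyEq ?_
    filter_upwards [Iio_mem_nhds hs] with t ht
    rw [h0 t ht, mul_zero]
  · exact ((contDiffAt_id.pow k).inv (pow_ne_zero k (by simp; linarith))).mul hh.contDiffAt

/-- A smooth function increasing from `0` on `(-∞, 1]` to `1` on `[2, ∞)`. -/
noncomputable def step (s : ℝ) : ℝ := Real.smoothTransition (s - 1)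

theorem contDiff_step : ContDiff ℝ ∞ step :=
  (Real.smoothTransition.contDiff (n := ⊤)).comp (contDiff_id.sub contDiff_const)

theorem step_of_le {s : ℝ} (hs : s ≤ 1) : step s = 0 :=
  Real.smoothTransition.zero_of_nonpos (by linarith)

theorem step_of_ge {s : ℝ} (hs : 2 ≤ s) : step s = 1 :=
  Real.smoothTransition.one_of_one_le (by linarith)

theorem step_pos {s : ℝ} (hs : 1 < s) : 0 < step s :=
  Real.smoothTransition.pos_of_pos (by linarith)

theorem step_mono : Monotone step := fun _ _ h =>
  Real.smoothTransition.monotone (by linarith)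

theorem deriv_step_of_lt {s : ℝ} (hs : s < 1) : deriv step s = 0 := by
  have : step =ᶠ[𝓝 s] fun _ => 0 := by
    filter_upwards [Iio_mem_nhds hs] with t ht using step_of_le ht.le
  rw [this.deriv_eq]
  simp

theorem deriv_step_of_gt {s : ℝ} (hs : 2 < s) : deriv step s = 0 := by
  have : step =ᶠ[𝓝 s] fun _ => 1 := by
    filter_upwards [Ioi_mem_nhds hs] with t ht using step_of_ge ht.le
  rw [this.deriv_eq]
  simp

theorem contDiff_deriv_step : ContDiff ℝ ∞ (deriv step) :=
  (contDiff_infty_iff_deriv.1 contDiff_step).2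

theorem isWeight_deriv_step (k : ℕ) : IsWeight (fun s => (s ^ k)⁻¹ * deriv step s) where
  continuous := (contDiff_inv_pow_mul contDiff_deriv_step (fun _ => deriv_step_of_lt) k).continuous
  eq_zero_of_lt_one s hs := by rw [deriv_step_of_lt hs, mul_zero]
  exists_bound := ⟨2, fun s hs => by rw [deriv_step_of_gt hs, mul_zero]⟩

/-- A bump function, the difference of a step and its dilation. -/
noncomputable def bump (q s : ℝ) : ℝ := step s - step (s / q)

variable {q : ℝ}

theorem contDiff_bump : ContDiff ℝ ∞ (bump q) :=
  contDiff_step.sub (contDiff_step.comp (contDiff_id.div_const q))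

theorem bump_nonneg (hq : 1 < q) {s : ℝ} (hs : 0 ≤ s) : 0 ≤ bump q s :=
  sub_nonneg.2 (step_mono (div_le_self hs hq.le))

theorem bump_of_lt (hq : 1 < q) {s : ℝ} (hs : s < 1) : bump q s = 0 := by
  have : s / q ≤ 1 := by
    rw [div_le_one (by linarith)]
    linarith
  rw [bump, step_of_le hs.le, step_of_le this, sub_zero]

theorem bump_of_gt (hq : 1 < q) {s : ℝ} (hs : 2 * q < s) : bump q s = 0 := by
  have : 2 ≤ s / q := by
    rw [le_div_iff₀ (by linarith)]
    exact hs.le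
  rw [bump, step_of_ge (by nlinarith), step_of_ge this, sub_self]

theorem bump_pos (hq : 1 < q) : 0 < bump q q := by
  rw [bump, div_self (by linarith), step_of_le le_rfl, sub_zero]
  exact step_pos hq

theorem deriv_bump (s : ℝ) : deriv (bump q) s = deriv step s - q⁻¹ * deriv step (s / q) := by
  have h1 := (contDiff_step.differentiable (by simp) s).hasDerivAt
  have h2 := (contDiff_step.differentiable (by simp) (s / q)).hasDerivAt.comp s
    ((hasDerivAt_id s).div_const q)
  have h3 := (h1.sub h2).deriv
  change deriv (bump q) s = _ at h3
  rw [h3]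
  ring

/-- The derivative of the radial test function. -/
noncomputable def testDeriv (q s : ℝ) : ℝ := (s ^ 2)⁻¹ * bump q s

theorem contDiff_testDeriv (hq : 1 < q) : ContDiff ℝ ∞ (testDeriv q) :=
  contDiff_inv_pow_mul contDiff_bump (fun _ => bump_of_lt hq) 2

theorem testDeriv_of_lt (hq : 1 < q) {s : ℝ} (hs : s < 1) : testDeriv q s = 0 := by
  rw [testDeriv, bump_of_lt hq hs, mul_zero]

theorem testDeriv_of_gt (hq : 1 < q) {s : ℝ} (hs : 2 * q < s) : testDeriv q s = 0 := by
  rw [testDeriv, bump_of_gt hq hs, mul_zero]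

theorem isWeight_testDeriv (hq : 1 < q) : IsWeight (testDeriv q) where
  continuous := (contDiff_testDeriv hq).continuous
  eq_zero_of_lt_one _ := testDeriv_of_lt hq
  exists_bound := ⟨2 * q, fun _ => testDeriv_of_gt hq⟩

theorem isWeight_deriv_testDeriv (hq : 1 < q) : IsWeight (deriv (testDeriv q)) where
  continuous := (contDiff_infty_iff_deriv.1 (contDiff_testDeriv hq)).2.continuous
  eq_zero_of_lt_one s hs := by
    have : testDeriv q =ᶠ[𝓝 s] fun _ => 0 := by
      filter_upwards [Iio_mem_nhds hs] with t ht using testDeriv_of_lt hq ht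
    rw [this.deriv_eq]
    simp
  exists_bound := ⟨2 * q, fun s hs => by
    have : testDeriv q =ᶠ[𝓝 s] fun _ => 0 := by
      filter_upwards [Ioi_mem_nhds hs] with t ht using testDeriv_of_gt hq ht
    rw [this.deriv_eq]
    simp⟩

theorem deriv_testDeriv {s : ℝ} (hs : s ≠ 0) : deriv (testDeriv q) s =
    (s ^ 2)⁻¹ * deriv (bump q) s - 2 * ((s ^ 3)⁻¹ * bump q s) := by
  have h1 := ((hasDerivAt_pow 2 s).inv (pow_ne_zero 2 hs)).mul
    ((contDiff_bump (q := q)).differentiable (by simp) s).hasDerivAt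
  have h3 := h1.deriv
  change deriv (testDeriv q) s = _ at h3
  rw [h3]
  simp
  field_simp
  ring

/-- A primitive of `testDeriv`. -/
noncomputable def testPrimitive (q s : ℝ) : ℝ := ∫ t in (0 : ℝ)..s, testDeriv q t

theorem hasDerivAt_testPrimitive (hq : 1 < q) (s : ℝ) :
    HasDerivAt (testPrimitive q) (testDeriv q s) s :=
  (contDiff_testDeriv hq).continuous.integral_hasStrictDerivAt 0 s |>.hasDerivAt

theorem contDiff_testPrimitive (hq : 1 < q) : ContDiff ℝ ∞ (testPrimitive q) := by
  rw [contDiff_infty_iff_deriv]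
  refine ⟨fun s => (hasDerivAt_testPrimitive hq s).differentiableAt, ?_⟩
  rw [show deriv (testPrimitive q) = testDeriv q from
    funext fun s => (hasDerivAt_testPrimitive hq s).deriv]
  exact contDiff_testDeriv hq

theorem testPrimitive_of_lt (hq : 1 < q) {s : ℝ} (hs : s < 1) : testPrimitive q s = 0 := by
  rw [testPrimitive]
  refine intervalIntegral.integral_zero_ae (Filter.Eventually.of_forall fun t ht => ?_)
  refine testDeriv_of_lt hq (ht.2.trans_lt ?_)
  simpa using hs

/-- The radial test function. -/
noncomputable def testFun (q s : ℝ) : ℝ := testPrimitive q s - testPrimitive q (s / q)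

theorem contDiff_testFun (hq : 1 < q) : ContDiff ℝ ∞ (testFun q) :=
  (contDiff_testPrimitive hq).sub ((contDiff_testPrimitive hq).comp (contDiff_id.div_const q))

theorem testFun_of_lt (hq : 1 < q) {s : ℝ} (hs : s < 1) : testFun q s = 0 := by
  have : s / q < 1 := by
    rw [div_lt_one (by linarith)]
    linarith
  rw [testFun, testPrimitive_of_lt hq hs, testPrimitive_of_lt hq this, sub_zero]

/-- The primitive is constant, but in general not zero, beyond the support of `testDeriv`.
Subtracting its dilate removes this constant, since `testFun` is the integral of `testDeriv` from
`s/q` to `s`. -/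
theorem testFun_of_gt (hq : 1 < q) {s : ℝ} (hs : 2 * q ^ 2 < s) : testFun q s = 0 := by
  have h1 : 2 * q < s / q := by
    rw [lt_div_iff₀ (by linarith)]
    linarith
  have h2 : s / q ≤ s := div_le_self (by nlinarith) hq.le
  have hi : ∀ a b, IntervalIntegrable (testDeriv q) volume a b := fun a b =>
    (contDiff_testDeriv hq).continuous.intervalIntegrable a b
  rw [testFun, testPrimitive, testPrimitive,
    intervalIntegral.integral_interval_sub_left (hi _ _) (hi _ _)]
  refine intervalIntegral.integral_zero_ae (Filter.Eventually.of_forall fun t ht => ?_)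
  refine testDeriv_of_gt hq (h1.trans ?_)
  rw [Set.uIoc_of_le h2] at ht
  exact ht.1

theorem deriv_testFun (hq : 1 < q) :
    deriv (testFun q) = fun s => testDeriv q s - q⁻¹ * testDeriv q (s / q) := by
  funext s
  have h := ((hasDerivAt_testPrimitive hq s).sub
    ((hasDerivAt_testPrimitive hq (s / q)).comp s ((hasDerivAt_id s).div_const q))).deriv
  change deriv (testFun q) s = _ at h
  rw [h]
  ring

theorem deriv_deriv_testFun (hq : 1 < q) (s : ℝ) :
    deriv (deriv (testFun q)) s =
      deriv (testDeriv q) s - (q ^ 2)⁻¹ * deriv (testDeriv q) (s / q) := by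
  rw [deriv_testFun hq]
  have hd := (contDiff_testDeriv hq).differentiable (by simp)
  have h := ((hd s).hasDerivAt.sub
    ((((hd (s / q)).hasDerivAt.comp s ((hasDerivAt_id s).div_const q))).const_mul q⁻¹)).deriv
  refine Eq.trans h ?_
  field_simp

end Scaling

end S5S1

end Weights

/-! ### The contradiction from homogeneity and positivity -/

section Nonexistence

open scoped Topology ContDiff
open MeasureTheory

namespace S5S1

theorem integral_weight_sub {a b : ℝ → ℝ} (ha : IsWeight a) (hb : IsWeight b) (c : ℝ) {g : C3 → ℝ}
    (hg : ∀ z ≠ 0, ContinuousAt g z) :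
    ∫ z : C3, (a (‖z‖ ^ 2) - c * b (‖z‖ ^ 2)) * g z =
      (∫ z : C3, a (‖z‖ ^ 2) * g z) - c * ∫ z : C3, b (‖z‖ ^ 2) * g z := by
  rw [← integral_const_mul, ← integral_sub (ha.integrable hg) ((hb.integrable hg).const_mul c)]
  congr 1
  funext z
  ring

theorem IsWeight.sub_const_mul {a b : ℝ → ℝ} (ha : IsWeight a) (hb : IsWeight b) (c : ℝ) :
    IsWeight (fun s => a s - c * b s) where
  continuous := ha.continuous.sub (continuous_const.mul hb.continuous)
  eq_zero_of_lt_one s hs := by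
    rw [ha.eq_zero_of_lt_one s hs, hb.eq_zero_of_lt_one s hs, mul_zero, sub_zero]
  exists_bound := by
    obtain ⟨R, hR⟩ := ha.exists_bound
    obtain ⟨R', hR'⟩ := hb.exists_bound
    refine ⟨max R R', fun s hs => ?_⟩
    rw [hR s ((le_max_left _ _).trans_lt hs), hR' s ((le_max_right _ _).trans_lt hs), mul_zero,
      sub_zero]

theorem integral_congr_of_ne_zero {g h : C3 → ℝ} (H : ∀ z ≠ 0, g z = h z) :
    ∫ z, g z = ∫ z, h z := by
  refine integral_congr_ae ?_
  have h0 : ∀ᵐ y : C3, y ≠ 0 := by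
    rw [ae_iff]
    simp
  filter_upwards [h0] with y hy using H y hy

/-- Two functions with the homogeneity of the trace and of the radial part of a metric
on the quotient of `ℂ³ ∖ {0}` by a dilation do not satisfy the radial equations. -/
theorem not_radial_identity {c : ℂ} (hc : 1 < ‖c‖) {t f : C3 → ℝ}
    (ht : ∀ z ≠ 0, ContinuousAt t z) (hf : ∀ z ≠ 0, ContinuousAt f z)
    (htc : ∀ z ≠ 0, t z = ‖c‖ ^ 2 * t (c • z)) (hfc : ∀ z ≠ 0, f z = f (c • z))
    (hpos : ∀ z ≠ 0, 0 < f z)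
    (H : ∀ P : ℝ → ℝ, ContDiff ℝ ∞ P → (∀ s < 1, P s = 0) → (∃ R, ∀ s > R, P s = 0) →
      ∫ z, ((‖z‖ ^ 2 * deriv (deriv P) (‖z‖ ^ 2) + 2 * deriv P (‖z‖ ^ 2)) * t z
        - deriv (deriv P) (‖z‖ ^ 2) * f z) = 0) : False := by
  set q := ‖c‖ ^ 2 with hqdef
  have hq : 1 < q := by nlinarith
  have hq0 : q ≠ 0 := by linarith
  -- The Jacobian of multiplication by `c` is `|c|⁶ = q³`. The homogeneity of `t` lowers the
  -- exponent to 2 in `hT`.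
  have hF : ∀ η : ℝ → ℝ, ∫ z : C3, η (‖z‖ ^ 2 / q) * f z = q ^ 3 * ∫ z : C3, η (‖z‖ ^ 2) * f z := by
    intro η
    have := integral_weight_comp_div hc (g := f) (k := 1) (fun z hz => by rw [one_mul, ← hfc z hz]) η
    rw [one_mul] at this
    rw [← this, hqdef]
    ring
  have hT : ∀ η : ℝ → ℝ, ∫ z : C3, η (‖z‖ ^ 2 / q) * t z = q ^ 2 * ∫ z : C3, η (‖z‖ ^ 2) * t z := by
    intro η
    have := integral_weight_comp_div hc (g := t) (k := q) htc η
    refine mul_left_cancel₀ hq0 ?_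
    rw [← this, hqdef]
    ring
  have hφ := isWeight_testDeriv hq
  have hφ' := isWeight_deriv_testDeriv hq
  have hsphere : ∀ z : C3, z ≠ 0 → ‖z‖ ^ 2 ≠ 0 := fun z hz => by simpa using hz
  -- The coefficient `sP'' + 2P'` of the trace, with `P' = testDeriv`, written with `- (-2)` to fit
  -- `integral_weight_sub`.
  have hm : IsWeight (fun s => s * deriv (testDeriv q) s - (-2) * testDeriv q s) := by
    refine IsWeight.sub_const_mul (a := fun s => s * deriv (testDeriv q) s)
      ⟨continuous_id.mul hφ'.continuous, fun s hs => ?_, ?_⟩ hφ (-2)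
    · rw [hφ'.eq_zero_of_lt_one s hs, mul_zero]
    · obtain ⟨R, hR⟩ := hφ'.exists_bound
      exact ⟨R, fun s hs => by rw [hR s hs, mul_zero]⟩
  have hw : IsWeight (fun s => (s ^ 3)⁻¹ * bump q s) :=
    ⟨(contDiff_inv_pow_mul contDiff_bump (fun _ => bump_of_lt hq) 3).continuous,
      fun s hs => by rw [bump_of_lt hq hs, mul_zero],
      ⟨2 * q, fun s hs => by rw [bump_of_gt hq hs, mul_zero]⟩⟩
  have hn := isWeight_deriv_step
  -- the two scaled copies of the primitive contribute proportional terms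
  have key : ∫ z : C3, (‖z‖ ^ 2 * deriv (testDeriv q) (‖z‖ ^ 2) - (-2) * testDeriv q (‖z‖ ^ 2)) * t z =
      ∫ z : C3, deriv (testDeriv q) (‖z‖ ^ 2) * f z := by
    have h := H (testFun q) (contDiff_testFun hq) (fun s hs => testFun_of_lt hq hs)
      ⟨2 * q ^ 2, fun s hs => testFun_of_gt hq hs⟩
    have h1 := integral_weight_sub hm (hm.comp_div hq) q⁻¹ ht
    have h2 := integral_weight_sub hφ' (hφ'.comp_div hq) (q ^ 2)⁻¹ hf
    rw [hT (fun s => s * deriv (testDeriv q) s - (-2) * testDeriv q s)] at h1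
    rw [hF] at h2
    have h3 := integral_sub ((hm.sub_const_mul (hm.comp_div hq) q⁻¹).integrable ht)
      ((hφ'.sub_const_mul (hφ'.comp_div hq) (q ^ 2)⁻¹).integrable hf)
    rw [h1, h2] at h3
    -- Both parts acquire the same factor: `1 - q⁻¹q²` for `t` and `1 - q⁻²q³` for `f`. Dividing by
    -- it gives the radial identity for the primitive itself, although that need not have compact
    -- support.
    have h6 : (1 - q) * ((∫ z : C3, (‖z‖ ^ 2 * deriv (testDeriv q) (‖z‖ ^ 2)
        - (-2) * testDeriv q (‖z‖ ^ 2)) * t z) -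
      ∫ z : C3, deriv (testDeriv q) (‖z‖ ^ 2) * f z) = 0 := by
      refine (Eq.trans ?_ h3.symm).trans ((integral_congr_of_ne_zero fun z _ => ?_).trans h)
      · field_simp
      · rw [deriv_deriv_testFun hq, deriv_testFun hq]
        field_simp
        ring
    exact sub_eq_zero.1 ((mul_eq_zero.1 h6).resolve_left (by linarith))
  have hleft : ∫ z : C3, (‖z‖ ^ 2 * deriv (testDeriv q) (‖z‖ ^ 2)
      - (-2) * testDeriv q (‖z‖ ^ 2)) * t z = 0 := by
    -- The choice `P' = s⁻² bump` gives `sP'' + 2P' = s⁻¹ bump'`. This is `s⁻¹ step'` minus `q⁻²`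
    -- times its dilate, and the scaling of `t` makes the two integrals equal.
    have h1 := integral_weight_sub (hn 1) ((hn 1).comp_div hq) (q ^ 2)⁻¹ ht
    rw [hT (fun s => (s ^ 1)⁻¹ * deriv step s), ← mul_assoc, inv_mul_cancel₀ (by positivity),
      one_mul, sub_self] at h1
    rw [← h1]
    refine integral_congr_of_ne_zero fun z hz => ?_
    have := hsphere z hz
    rw [deriv_testDeriv this, deriv_bump, testDeriv]
    field_simp
    ring
  have hright : ∫ z : C3, deriv (testDeriv q) (‖z‖ ^ 2) * f z =
      -2 * ∫ z : C3, ((‖z‖ ^ 2) ^ 3)⁻¹ * bump q (‖z‖ ^ 2) * f z := by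
    -- Likewise `s⁻² bump'` is `s⁻² step'` minus `q⁻³` times its dilate and integrates to zero
    -- against `f`. Of `P''` only `-2 s⁻³ bump` contributes.
    have h1 := integral_weight_sub (hn 2) ((hn 2).comp_div hq) (q ^ 3)⁻¹ hf
    rw [hF (fun s => (s ^ 2)⁻¹ * deriv step s), ← mul_assoc, inv_mul_cancel₀ (by positivity),
      one_mul, sub_self] at h1
    have h2 := integral_weight_sub ((hn 2).sub_const_mul ((hn 2).comp_div hq) (q ^ 3)⁻¹) hw 2 hf
    rw [h1, zero_sub, ← neg_mul] at h2
    rw [← h2]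
    refine integral_congr_of_ne_zero fun z hz => ?_
    have := hsphere z hz
    rw [deriv_testDeriv this, deriv_bump]
    field_simp
  have hzero : ∫ z : C3, ((‖z‖ ^ 2) ^ 3)⁻¹ * bump q (‖z‖ ^ 2) * f z = 0 := by
    rw [hleft, hright] at key
    linarith
  have hnonneg : ∀ z : C3, 0 ≤ ((‖z‖ ^ 2) ^ 3)⁻¹ * bump q (‖z‖ ^ 2) * f z := by
    intro z
    rcases eq_or_ne z 0 with rfl | hz
    · simp
    · have := bump_nonneg hq (s := ‖z‖ ^ 2) (by positivity)
      have := hpos z hz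
      positivity
  refine absurd hzero (ne_of_gt ?_)
  rw [integral_pos_iff_support_of_nonneg hnonneg (hw.integrable hf)]
  have hopen : IsOpen ({z : C3 | 0 < bump q (‖z‖ ^ 2)} ∩ {0}ᶜ) :=
    (isOpen_lt continuous_const (contDiff_bump.continuous.comp (continuous_norm.pow 2))).inter
      isOpen_compl_singleton
  have hne : (({z : C3 | 0 < bump q (‖z‖ ^ 2)} ∩ {0}ᶜ) : Set C3).Nonempty := by
    -- At this point `|z|² = q`, where `bump` equals `step q > 0` because `step 1 = 0`.
    refine ⟨c • stdVec 0, ?_, ?_⟩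
    · have hcn : ‖c • stdVec 0‖ = ‖c‖ := by
        rw [norm_smul, stdVec, PiLp.norm_single]
        simp
      rw [Set.mem_ofPred_eq, hcn, ← hqdef]
      exact bump_pos hq
    · rw [Set.mem_compl_singleton_iff, ← norm_ne_zero_iff, norm_smul, stdVec,
        PiLp.norm_single]
      simp
      intro h
      simp [h] at hc
      linarith
  refine lt_of_lt_of_le (hopen.measure_pos volume hne) (measure_mono ?_)
  rintro z ⟨hz1, hz2⟩
  have h1 : 0 < bump q (‖z‖ ^ 2) := hz1
  have h2 := hpos z hz2
  have h3 : 0 < ‖z‖ := norm_pos_iff.2 hz2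
  exact ne_of_gt (by positivity)

/-- There is no positive real `∂∂̄`-closed form of type `(1,1)` on `ℂ³ ∖ {0}` which is invariant
under a dilation. -/
theorem not_exists_invariant_pluriclosed {c : ℂ} (hc : 1 < ‖c‖) {β : C3 → C3 [⋀^Fin 2]→L[ℝ] ℂ}
    (hs : ∀ z ≠ 0, ContDiffAt ℝ ∞ β z)
    (hβ : ∀ z ≠ 0, ∀ a b, β z ![mulI a, mulI b] = β z ![a, b])
    (hreal : ∀ z ≠ 0, ∀ a b, (β z ![a, b]).im = 0)
    (hpos : ∀ z ≠ 0, ∀ a, a ≠ 0 → 0 < (β z ![a, mulI a]).re)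
    (hcl : ∀ z ≠ 0, flatDel mulI (flatDelbar mulI β) z = 0)
    (hinv : ∀ z ≠ 0, ∀ v : Fin 2 → C3, β (c • z) (fun i => c • v i) = β z v) : False := by
  have hre : ∀ z ≠ 0, ∀ a b, β z ![a, b] = ((β z ![a, b]).re : ℂ) := fun z hz a b =>
    Complex.ext (by simp) (by simp [hreal z hz a b])
  have hc0 : c ≠ 0 := by
    rintro rfl
    simp at hc
    linarith
  -- With `a = z` this is the invariance of `f`. With `a` a coordinate vector, `hquad` supplies the
  -- factor `|c|²` in the homogeneity of the trace.
  have hinv' : ∀ z ≠ 0, ∀ a, β z ![a, mulI a] = β (c • z) ![c • a, mulI (c • a)] := by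
    intro z hz a
    rw [← hinv z hz]
    congr 1
    funext i
    fin_cases i
    · rfl
    · change c • Complex.I • a = Complex.I • c • a
      exact smul_comm _ _ _
  have hquad : ∀ z ≠ 0, ∀ a, β z ![c • a, mulI (c • a)] = (‖c‖ ^ 2 : ℝ) * β z ![a, mulI a] := by
    intro z hz a
    have h1 : c • a = c.re • a + c.im • mulI a := by
      rw [mulI_apply]
      conv_lhs => rw [← Complex.re_add_im c]
      rw [add_smul, mul_smul, Complex.coe_smul, Complex.coe_smul]
    have h2 : mulI (c • a) = c.re • mulI a - c.im • a := by
      rw [h1, map_add, map_smul, map_smul, mulI_mulI, smul_neg, sub_eq_add_neg]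
    have h0 : ∀ v, β z ![v, v] = 0 := fun v =>
      (β z).map_eq_zero_of_eq ![v, v] (i := 0) (j := 1) rfl (by decide)
    rw [h2, h1, ← twoFormBilin_apply, ← Complex.normSq_eq_norm_sq, Complex.normSq_apply]
    simp only [map_add, map_sub, map_smul, LinearMap.add_apply, LinearMap.smul_apply,
      twoFormBilin_apply, hβ z hz, map_left_eq_neg mulI_mulI (hβ z hz), Complex.real_smul, h0]
    push_cast
    ring
  have hW : ∀ p q, ∀ z ≠ 0, ContinuousAt (fun y => β y ![p, q]) z := fun p q z hz =>
    ((hs z hz).continuousAlternatingMap_apply_const ![p, q]).continuousAt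
  refine not_radial_identity hc (t := fun z => ∑ a, (β z ![stdVec a, mulI (stdVec a)]).re)
    (f := fun z => (β z ![z, mulI z]).re) ?_ ?_ ?_ ?_ ?_ ?_
  · intro z hz
    exact tendsto_finsetSum _ fun a _ =>
      (Complex.continuous_re.continuousAt.comp (hW (stdVec a) (mulI (stdVec a)) z hz))
  · intro z hz
    refine Complex.continuous_re.continuousAt.comp (f := fun y => β y ![y, mulI y]) ?_
    have h : (fun y => β y ![y, mulI y]) =ᶠ[𝓝 z] fun y => ∑ a, ∑ b,
      (((y a).re * (y b).re + (y a).im * (y b).im : ℝ) * β y ![stdVec a, mulI (stdVec b)]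
        - ((y a).re * (y b).im - (y a).im * (y b).re : ℝ) * β y ![stdVec a, stdVec b]) := by
      filter_upwards [isOpen_compl_singleton.mem_nhds hz] with y hy using apply_self_mulI (hβ y hy) y
    refine ContinuousAt.congr ?_ h.symm
    refine tendsto_finsetSum _ fun a _ => tendsto_finsetSum _ fun b _ => ?_
    refine ContinuousAt.sub (ContinuousAt.mul ?_ (hW _ _ z hz)) (ContinuousAt.mul ?_ (hW _ _ z hz))
    · exact Continuous.continuousAt (by fun_prop)
    · exact Continuous.continuousAt (by fun_prop)
  · intro z hz
    rw [Finset.mul_sum]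
    refine Finset.sum_congr rfl fun a _ => ?_
    rw [hinv' z hz, hquad _ (smul_ne_zero hc0 hz), Complex.re_ofReal_mul]
  · intro z hz
    exact congrArg Complex.re (hinv' z hz z)
  · exact fun z hz => hpos z hz z hz
  · rintro P hP hP1 ⟨R, hPR⟩
    have h := integral_radial_eq_zero hs hβ hcl hP one_pos hP1 hPR
    have h' : ∫ z : C3, (((‖z‖ ^ 2 * deriv (deriv P) (‖z‖ ^ 2) + 2 * deriv P (‖z‖ ^ 2)) *
        (∑ a, (β z ![stdVec a, mulI (stdVec a)]).re)
        - deriv (deriv P) (‖z‖ ^ 2) * (β z ![z, mulI z]).re : ℝ) : ℂ) = 0 := by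
      rw [← h]
      refine integral_congr_ae ?_
      have h0 : ∀ᵐ y : C3, y ≠ 0 := by
        rw [ae_iff]
        simp
      filter_upwards [h0] with z hz
      rw [hre z hz z (mulI z), Finset.sum_congr rfl fun a _ => hre z hz (stdVec a) _]
      push_cast
      simp
    rw [integral_complex_ofReal] at h'
    exact_mod_cast h'

end S5S1

end Nonexistence

theorem mainTheorem12 (τ : ℂ) (hτ : τ.im ≠ 0) :
    ¬ ∃ ω : DiffForm S5S1.model S5S1 2,
        IsHermitianMetric (S5S1.complexStructure τ) ω ∧
          IsPluriclosed (S5S1.complexStructure τ) ω := by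
  rintro ⟨ω, hω, hcl⟩
  have hchart : ∀ z : C3, z ≠ 0 → ∀ᶠ y in nhds z,
      IsHolomorphicChartAt S5S1.mulI (S5S1.complexStructure τ) (S5S1.hopfCover τ) y := by
    intro z hz
    filter_upwards [isOpen_compl_singleton.mem_nhds hz] with y hy
      using S5S1.isHolomorphicChartAt_hopfCover τ hτ hy
  have hsmooth : ∀ z : C3, z ≠ 0 →
      ContDiffAt ℝ ((⊤ : ℕ∞) : WithTop ℕ∞) (ω.pullback (S5S1.hopfCover τ)) z := fun z hz =>
    hω.smooth.contDiffAt_pullback (S5S1.isHolomorphicChartAt_hopfCover τ hτ hz).smooth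
  have happly : ∀ (z a b : C3), ω.pullback (S5S1.hopfCover τ) z ![a, b] =
      ω (S5S1.hopfCover τ z) ![mfderiv 𝓘(ℝ, C3) S5S1.model (S5S1.hopfCover τ) z a,
        mfderiv 𝓘(ℝ, C3) S5S1.model (S5S1.hopfCover τ) z b] := by
    intro z a b
    rw [DiffForm.pullback_apply]
    congr 1
    funext i
    fin_cases i <;> rfl
  refine S5S1.not_exists_invariant_pluriclosed (S5S1.one_lt_norm_deckFactor τ hτ)
    (β := ω.pullback (S5S1.hopfCover τ)) hsmooth ?_ ?_ ?_ ?_ ?_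
  · intro z hz a b
    rw [happly, happly, S5S1.mfderiv_hopfCover_mulI τ hτ hz, S5S1.mfderiv_hopfCover_mulI τ hτ hz]
    exact hω.type_one_one _ _ _
  · intro z hz a b
    rw [happly]
    exact hω.real _ _ _
  · intro z hz a ha
    rw [happly, S5S1.mfderiv_hopfCover_mulI τ hτ hz]
    exact hω.pos _ _ fun h => ha (S5S1.mfderiv_hopfCover_injective τ hτ hz a h)
  · intro z hz
    -- The flat `∂∂̄` of the pullback is the pullback of `∂∂̄ω`, which is zero.
    rw [← IsHolomorphicChartAt.pullback_del_delbar (hchart z hz) (by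
      filter_upwards [isOpen_compl_singleton.mem_nhds hz] with y hy using hsmooth y hy)]
    rw [IsPluriclosed] at hcl
    rw [hcl]
    rfl
  · intro z hz v
    exact S5S1.pullback_hopfCover_deckFactor τ hτ ω hz v
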